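/- Let $X$ be a smooth projective connected curve over $\mathbb C$ with canonical bundle $K_X$, let $m\ge 1$, and let $b_{2i}\in H^0(X,K_X^{2i})$ $(1\le i\le m-1)$ and $p_m\in H^0(X,K_X^m)$. Assume that all zeros of $p_m$ are simple (in particular $p_m\neq 0$) and, if $m\ge 2$, that $b_{2m-2}$ does not vanish at any zero of $p_m$. Let $\lambda$ be the tautological section of the pullback of $K_X$ to the total space $\mathrm{tot}(K_X)$, and let $\pi':S'\to X$ be the curve $$S'=\{\lambda^{2m}+b_2\lambda^{2m-2}+\cdots+b_{2m-2}\lambda^2+p_m^2=0\}\subset \mathrm{tot}(K_X).$$ Assume that $S'$ is reduced. Let $\mu:S\to S'$ be the normalization, let $\sigma:S\to S$ be the lift of the involution $\lambda\mapsto-\lambda$ of $S'$, let $p:S\to\overline S=S/\sigma$ be the quotient, and let $\overline\pi:\overline S\to X$ be the induced map, $\overline\pi\circ p=\pi'\circ\mu$. Let $\mathcal L\subset p_*\mathcal O_S$ be the $(-1)$-eigensheaf of $\sigma$, so that $p_*\mathcal O_S=\mathcal O_{\overline S}\oplus\mathcal L$. Then $p$ is étale, $\overline\pi$ is finite and flat,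 $\mathcal L$ is a line bundle with $\mathcal L\otimes\mathcal L\simeq\mathcal O_{\overline S}$, and its norm is trivial: $$\mathrm{Nm}_{\overline S/X}(\mathcal L)\simeq\mathcal O_X .$$ Here, for a line bundle $L$ on $\overline S$, $\mathrm{Nm}_{\overline S/X}(L)$ is the line bundle on $X$ whose transition functions are the norms of those of $L$; equivalently, it is the line bundle that carries a norm map $N:\overline\pi_*L\to \mathrm{Nm}_{\overline S/X}(L)$ of sheaves of sets with $N(ae)=\mathrm{Nm}(a)N(e)$ for functions $a$, taking generators to generators. -/

import Mathlib

open CategoryTheory CategoryTheory.Limits AlgebraicGeometry Polynomial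

noncomputable section

namespace SpectralNorm

/-! ### Powers of the canonical bundle, through local frames -/

section Canonical

variable {X : Scheme.{0}} (s : X ⟶ Spec (CommRingCat.of ℂ))

/-- The structure map `ℂ = Γ(Spec ℂ, ⊤) ⟶ Γ(X, U)`. -/
def structureMap (U : X.Opens) : Γ(Spec (CommRingCat.of ℂ), ⊤) ⟶ Γ(X, U) :=
  s.appLE ⊤ U le_top

/-- The module `Ω_{Γ(X, U)/ℂ}` of Kähler differentials. For affine `U` this is `Γ(U, K_X)`, when
`X` is a smooth curve. -/
abbrev Differentials (U : X.Opens) : ModuleCat Γ(X, U) :=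
  CommRingCat.KaehlerDifferential (structureMap s U)

theorem structureMap_res {U V : X.Opens} (h : V ≤ U) :
    𝟙 _ ≫ structureMap s V = structureMap s U ≫ X.presheaf.map (homOfLE h).op := by
  rw [Category.id_comp]
  exact (s.appLE_map _ _).symm

/-- Restriction of differentials from `U` to `V ≤ U`. -/
def resDifferential {U V : X.Opens} (h : V ≤ U) (ω : Differentials s U) : Differentials s V :=
  (CommRingCat.KaehlerDifferential.map (structureMap_res s h)).hom ω

/-- A local frame of `K_X` over `U`: a differential `ω` which is a basis of `Ω_{Γ(X, U)/ℂ}`. -/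
structure Frame (U : X.Opens) where
  form : Differentials s U
  bijective : Function.Bijective fun r : Γ(X, U) => r • form

/-- A global section of `K_X ^ n`, given by its coefficients in all local frames: over an affine
open `U` with frame `ω` the section is `coeff U ω • ω ^ n`. The condition says that these local
expressions agree: if `ω = u • ω'` over `V ≤ U`, then `coeff V ω' = u ^ n * coeff U ω` there. -/
structure CanonicalSection (n : ℕ) where
  coeff : ∀ U : X.affineOpens, Frame s U.1 → Γ(X, U.1)
  coeff_res : ∀ (U V : X.affineOpens) (h : V.1 ≤ U.1) (ω : Frame s U.1) (ω' : Frame s V.1)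
    (u : Γ(X, V.1)), resDifferential s h ω.form = u • ω'.form →
      coeff V ω' = u ^ n * X.presheaf.map (homOfLE h).op (coeff U ω)

/-- A global section of `π^* K_X` for a morphism `π : Y ⟶ X`, given by its coefficients: over
`π⁻¹ U` the section is `coeff U ω • π^* ω`. -/
structure PullbackSection {Y : Scheme.{0}} (π : Y ⟶ X) where
  coeff : ∀ U : X.affineOpens, Frame s U.1 → Γ(Y, π ⁻¹ᵁ U.1)
  coeff_res : ∀ (U V : X.affineOpens) (h : V.1 ≤ U.1) (ω : Frame s U.1) (ω' : Frame s V.1)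
    (u : Γ(X, V.1)), resDifferential s h ω.form = u • ω'.form →
      coeff V ω' = π.app V.1 u *
        Y.presheaf.map (homOfLE (π.preimage_mono h)).op (coeff U ω)

variable {s}

/-- The section `c` vanishes at the point `x`. -/
def CanonicalSection.VanishesAt {n : ℕ} (c : CanonicalSection s n) (x : X) : Prop :=
  ∀ (U : X.affineOpens) (ω : Frame s U.1) (hx : x ∈ U.1),
    X.presheaf.germ U.1 x hx (c.coeff U ω) ∈ IsLocalRing.maximalIdeal (X.presheaf.stalk x)

/-- All zeros of the section `c` are simple: its germ at `x` never lies in `𝔪_x ^ 2`. In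
particular `c` is not the zero section. -/
def CanonicalSection.HasSimpleZeros {n : ℕ} (c : CanonicalSection s n) : Prop :=
  ∀ (x : X) (U : X.affineOpens) (ω : Frame s U.1) (hx : x ∈ U.1),
    X.presheaf.germ U.1 x hx (c.coeff U ω) ∉ IsLocalRing.maximalIdeal (X.presheaf.stalk x) ^ 2

/-! ### The spectral curve -/

/-- The polynomial `t^{2m} + b_2 t^{2m-2} + ⋯ + b_{2m-2} t^2 + p_m^2` in the frame `ω` over `U`.
Here `b i` is the coefficient `b_{2i}`; only the indices `1 ≤ i < m` are used. -/
def spectralPolynomial (m : ℕ) (b : ∀ i : ℕ, CanonicalSection s (2 * i))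
    (pm : CanonicalSection s m) (U : X.affineOpens) (ω : Frame s U.1) : Γ(X, U.1)[X] :=
  Polynomial.X ^ (2 * m)
    + ∑ i ∈ Finset.Ico 1 m, C ((b i).coeff U ω) * Polynomial.X ^ (2 * (m - i))
    + C (pm.coeff U ω ^ 2)

/-- `π' : S' ⟶ X`, with the tautological section `lam` of `π'^* K_X`, is the closed subscheme of the
total space of `K_X` with equation
`λ^{2m} + b_2 λ^{2m-2} + ⋯ + b_{2m-2} λ^2 + p_m^2 = 0`.
A frame `ω` over an affine open `U` identifies the total space over `U` with `Spec Γ(X, U)[t]`,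
`λ = t • ω`; so the condition is that `t ↦ lam.coeff U ω` presents `Γ(S', π'⁻¹ U)` as the quotient
of `Γ(X, U)[t]` by the spectral polynomial. -/
structure IsSpectralCurve (m : ℕ) (b : ∀ i : ℕ, CanonicalSection s (2 * i))
    (pm : CanonicalSection s m) {S' : Scheme.{0}} (π' : S' ⟶ X) (lam : PullbackSection s π') :
    Prop where
  isAffineHom : IsAffineHom π'
  surjective : ∀ (U : X.affineOpens) (ω : Frame s U.1),
    Function.Surjective (eval₂RingHom (π'.app U.1).hom (lam.coeff U ω))
  ker_eq : ∀ (U : X.affineOpens) (ω : Frame s U.1),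
    RingHom.ker (eval₂RingHom (π'.app U.1).hom (lam.coeff U ω)) =
      Ideal.span {spectralPolynomial m b pm U ω}

/-- `σ' : S' ⟶ S'` is the involution of `S'` over `X` with `λ ↦ -λ`. -/
structure IsSignInvolution {S' : Scheme.{0}} (π' : S' ⟶ X) (lam : PullbackSection s π')
    (σ' : S' ⟶ S') : Prop where
  comp_eq : σ' ≫ π' = π'
  map_coeff : ∀ (U : X.affineOpens) (ω : Frame s U.1)
    (h : π' ⁻¹ᵁ U.1 ≤ σ' ⁻¹ᵁ (π' ⁻¹ᵁ U.1)),
    σ'.appLE (π' ⁻¹ᵁ U.1) (π' ⁻¹ᵁ U.1) h (lam.coeff U ω) = -lam.coeff U ω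

end Canonical

/-! ### Normalization and quotient by an involution -/

/-- `μ : S ⟶ S'` is the normalization of the reduced scheme `S'`: `S` is normal, and `μ` is integral
and birational. -/
structure IsNormalization {S S' : Scheme.{0}} (μ : S ⟶ S') : Prop where
  isDomain_stalk : ∀ x : S, IsDomain (S.presheaf.stalk x)
  isIntegrallyClosed_stalk : ∀ x : S, IsIntegrallyClosed (S.presheaf.stalk x)
  isIntegralHom : IsIntegralHom μ
  birational : ∃ V : S'.Opens, Dense (V : Set S') ∧ Dense ((μ ⁻¹ᵁ V : S.Opens) : Set S) ∧
    IsIso (μ ∣_ V)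

/-- `p : S ⟶ Sbar` is the quotient of `S` by `σ`: `p` is affine and `σ`-invariant, and the functions
on `Sbar` are the `σ`-invariant functions on `S`. -/
structure IsQuotient {S Sbar : Scheme.{0}} (σ : S ⟶ S) (p : S ⟶ Sbar) : Prop where
  comp_eq : σ ≫ p = p
  isAffineHom : IsAffineHom p
  injective : ∀ V : Sbar.Opens, Function.Injective (p.app V)
  mem_range_iff : ∀ (V : Sbar.Opens) (h : p ⁻¹ᵁ V ≤ σ ⁻¹ᵁ (p ⁻¹ᵁ V)) (f : Γ(S, p ⁻¹ᵁ V)),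
    f ∈ Set.range (p.app V) ↔ σ.appLE (p ⁻¹ᵁ V) (p ⁻¹ᵁ V) h f = f

/-! ### Line bundles and their norms -/

/-- The structure sheaf as a sheaf of modules. -/
def structureSheaf (X : Scheme.{0}) : X.Modules := SheafOfModules.unit X.ringCatSheaf

/-- The action `f ↦ f ∘ σ` of `σ` on `p_* 𝒪_S`, where `σ` is an endomorphism of `S` over `Sbar`. -/
def pushforwardAction {S Sbar : Scheme.{0}} (σ : S ⟶ S) (p : S ⟶ Sbar) (h : σ ≫ p = p) :
    (Scheme.Modules.pushforward p).obj (structureSheaf S) ⟶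
      (Scheme.Modules.pushforward p).obj (structureSheaf S) :=
  (Scheme.Modules.pushforward p).map
      (show structureSheaf S ⟶ (Scheme.Modules.pushforward σ).obj (structureSheaf S) from
        SheafOfModules.unitToPushforwardObjUnit σ.toRingCatSheafHom) ≫
    (Scheme.Modules.pushforwardComp σ p).hom.app (structureSheaf S) ≫
    (Scheme.Modules.pushforwardCongr h).hom.app (structureSheaf S)

/-- The sheaf `ℒ` of a double cover `p : S ⟶ Sbar` with involution `σ`: the `(-1)`-eigensheaf of
`σ` on `p_* 𝒪_S`, so that `p_* 𝒪_S = 𝒪 ⊕ ℒ`. -/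
def antiInvariants {S Sbar : Scheme.{0}} (σ : S ⟶ S) (p : S ⟶ Sbar) (h : σ ≫ p = p) :
    Sbar.Modules :=
  kernel (𝟙 _ + pushforwardAction σ p h)

/-- `e` is a generator of `L` over `U`: multiplication by `e` is an isomorphism from `𝒪_U` to the
restriction of `L` to `U`. -/
def IsGenerator {Y : Scheme.{0}} (L : Y.Modules) {U : Y.Opens} (e : Γ(L, U)) : Prop :=
  ∀ (V : Y.Opens) (h : V ≤ U),
    Function.Bijective fun a : Γ(Y, V) => a • L.presheaf.map (homOfLE h).op e

/-- `L` is a line bundle: it is locally generated by one section without relations. -/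
def IsLineBundle {Y : Scheme.{0}} (L : Y.Modules) : Prop :=
  ∀ y : Y, ∃ U : Y.Opens, y ∈ U ∧ ∃ e : Γ(L, U), IsGenerator L e

/-- A line bundle `L` with `L ⊗ L ≃ 𝒪`: there is a bilinear pairing `L × L → 𝒪` such that
`β (e, e)` is invertible for every local generator `e` of `L`. -/
def IsTwoTorsion {Y : Scheme.{0}} (L : Y.Modules) : Prop :=
  ∃ β : ∀ U : Y.Opens, Γ(L, U) →ₗ[Γ(Y, U)] Γ(L, U) →ₗ[Γ(Y, U)] Γ(Y, U),
    (∀ (U V : Y.Opens) (h : V ≤ U) (a b : Γ(L, U)),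
      β V (L.presheaf.map (homOfLE h).op a) (L.presheaf.map (homOfLE h).op b) =
        Y.presheaf.map (homOfLE h).op (β U a b)) ∧
    ∀ (U : Y.Opens) (e : Γ(L, U)), IsGenerator L e → IsUnit (β U e e)

/-- The norm of a function on `π⁻¹ W`, in case `Γ(Y, π⁻¹ W)` is a finite free
`Γ(X, W)`-module: the determinant of multiplication by that function. -/
def functionNorm {X Y : Scheme.{0}} (π : Y ⟶ X) (W : X.Opens) (a : Γ(Y, π ⁻¹ᵁ W)) : Γ(X, W) :=
  letI := (π.app W).hom.toAlgebra
  Algebra.norm Γ(X, W) a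

/-- `Γ(Y, π⁻¹ W)` is a free `Γ(X, W)`-module. -/
def IsFreeOver {X Y : Scheme.{0}} (π : Y ⟶ X) (W : X.Opens) : Prop :=
  letI := (π.app W).hom.toAlgebra
  Module.Free Γ(X, W) Γ(Y, π ⁻¹ᵁ W)

/-- For a finite flat morphism `π : Y ⟶ X` of noetherian schemes and a line bundle `L` on `Y`, the
sheaf of modules `M` on `X` is (isomorphic to) the norm `Nm_π(L)`: there is a norm map
`N : π_* L → M` of sheaves of sets which satisfies `N (a e) = Nm (a) N (e)`, and which takes
generators of `L` over `π⁻¹ U` to generators of `M` over `U`.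
Since `L` is trivial over `π⁻¹ U` for small `U`, and `π_* 𝒪_Y` is free over small affine opens,
such an `M` is the line bundle on `X` with transition functions the norms of those of `L`; it is
unique up to a unique isomorphism compatible with `N`. -/
def IsNorm {X Y : Scheme.{0}} (π : Y ⟶ X) (L : Y.Modules) (M : X.Modules) : Prop :=
  ∃ N : ∀ U : X.Opens, Γ(L, π ⁻¹ᵁ U) → Γ(M, U),
    (∀ (U V : X.Opens) (h : V ≤ U) (e : Γ(L, π ⁻¹ᵁ U)),
      N V (L.presheaf.map (homOfLE (π.preimage_mono h)).op e) =
        M.presheaf.map (homOfLE h).op (N U e)) ∧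
    (∀ W : X.Opens, IsAffineOpen W → IsFreeOver π W →
      ∀ (a : Γ(Y, π ⁻¹ᵁ W)) (e : Γ(L, π ⁻¹ᵁ W)), N W (a • e) = functionNorm π W a • N W e) ∧
    ∀ (U : X.Opens) (e : Γ(L, π ⁻¹ᵁ U)), IsGenerator L e → IsGenerator M (N U e)

end SpectralNorm

end

/-! Over an affine open `U` of `X` with a frame of `K_X`, let `A`, `C`, `B` be the functions on `U`
and on its preimages in `Sbar` and `S`, and write the spectral polynomial as `g(t ^ 2)`, where `g(0)
= p ^ 2` and `p` is the coefficient of `p_m`. The function `lam ∈ B` is anti-invariant and satisfies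
`g(lam ^ 2) = 0`.

Étaleness. The equation reads `p ^ 2 = -lam ^ 2 (k lam ^ 2 + b)`, with `b` the coefficient of `t` in
`g`. So `lam ^ 2` divides `p ^ 2`, and `lam` divides `p` since `S` is normal. The cofactor `y = p /
lam` is anti-invariant, with `y ^ 2 = -(k lam ^ 2 + b)`. Since `b` and `p` have no common zero,
there is a relation `c lam ^ 2 + d y ^ 2 = 1` with `c, d ∈ C` (`SpectralModel.exists_cofactor`).
Hence near each point of `Sbar` one of `lam`, `y` is invertible. It generates `ℒ`, multiplication of
functions pairs `ℒ` with itself into `𝒪`, and `p : S ⟶ Sbar` is étale (`etale_of_antiInvariant`).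

Norm. Globally `lam` is a section of `ℒ ⊗ πbar^* K_X`, and the square of its norm is `(-1) ^ m p_m ^
2`; comparing that norm with `p_m` trivializes `Nm(ℒ)`. Concretely, `A[t]/(g)` embeds in `C` with
torsion cokernel, so `C` has rank `m` and `Nm(lam ^ 2) = (-1) ^ m p ^ 2`. For `f` in `ℒ` the product
`f lam` lies in `C`, and `Nm(f lam) ^ 2 = (-1) ^ m p ^ 2 Nm(f ^ 2)`; as `A` is integrally closed,
`p` divides `Nm(f lam)` (`SpectralModel.norm_antiInvariant`). The norm map is `N(f) = Nm(f lam) /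
p`. A change of frame multiplies numerator and denominator by the same `u ^ m`, so the local
quotients glue. Finally `N(f) ^ 2 = (-1) ^ m Nm(f ^ 2)`, so `N` takes units to units.

Two inputs remain. Smoothness in dimension one makes `A` integrally closed and torsion-free modules
flat. Birationality makes `B` agree with `A[t]/(g(t ^ 2))` up to `A`-torsion (`spectralModel`). -/

noncomputable section

namespace SpectralNorm

/-! ### Smooth curves over a field -/

section SmoothCurve

open IsLocalRing TensorProduct

/-- The residue field `κ` is formally smooth over the perfect field `k`, so the conormal map `𝔪/𝔪² →
κ ⊗ Ω` is a split injection. As `Ω` is cyclic, `𝔪/𝔪²` has dimension at most one, which for a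
noetherian local domain means a field or a discrete valuation ring. -/
theorem valuationRing_of_kaehlerDifferential_cyclic {k R : Type*} [Field k] [PerfectField k]
    [CommRing R] [IsDomain R] [IsLocalRing R] [IsNoetherianRing R] [Algebra k R]
    [Algebra.FormallySmooth k R] [Algebra.EssFiniteType k R]
    (ω : Ω[R⁄k]) (hω : Submodule.span R {ω} = ⊤) : ValuationRing R := by
  have hEss : Algebra.EssFiniteType k (ResidueField R) := by
    have : Algebra.FiniteType R (ResidueField R) :=
      Algebra.FiniteType.of_surjective (Algebra.ofId R (ResidueField R))
        IsLocalRing.residue_surjective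
    exact Algebra.EssFiniteType.comp k R (ResidueField R)
  have hsm : Algebra.FormallySmooth k (ResidueField R) := Algebra.FormallySmooth.of_perfectField
  have key : ∀ I : Ideal R, I = RingHom.ker (algebraMap R (ResidueField R)) →
      ∃ f : I.Cotangent →ₗ[R] ResidueField R ⊗[R] Ω[R⁄k], Function.Injective f := by
    rintro _ rfl
    obtain ⟨l, hl⟩ := (Algebra.FormallySmooth.iff_split_injection (R := k) (P := R)
      (A := ResidueField R) IsLocalRing.residue_surjective).mp hsm
    exact ⟨_, Function.LeftInverse.injective (g := l) fun x => DFunLike.congr_fun hl x⟩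
  obtain ⟨f, hf⟩ := key (maximalIdeal R) IsLocalRing.ker_residue.symm
  have hrank : Module.finrank (ResidueField R) (ResidueField R ⊗[R] Ω[R⁄k]) ≤ 1 := by
    refine finrank_le_one (1 ⊗ₜ ω) fun w => ?_
    induction w with
    | zero => exact ⟨0, zero_smul _ _⟩
    | add x y hx hy =>
      obtain ⟨a, rfl⟩ := hx
      obtain ⟨b, rfl⟩ := hy
      exact ⟨a + b, add_smul _ _ _⟩
    | tmul c x =>
      obtain ⟨r, rfl⟩ := Submodule.mem_span_singleton.mp (hω ▸ Submodule.mem_top : x ∈ _)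
      refine ⟨r • c, ?_⟩
      rw [TensorProduct.smul_tmul', TensorProduct.tmul_smul, smul_eq_mul, mul_one,
        TensorProduct.smul_tmul']
  have hfin : Module.Finite (ResidueField R) (ResidueField R ⊗[R] Ω[R⁄k]) := by
    have : Module.Finite R Ω[R⁄k] := ⟨⟨{ω}, by simpa using hω⟩⟩
    infer_instance
  have h1 : Module.finrank (ResidueField R) (CotangentSpace R) ≤ 1 :=
    (LinearMap.finrank_le_finrank_of_injective
      (f := f.extendScalarsOfSurjective (S := ResidueField R) IsLocalRing.residue_surjective)
      hf).trans hrank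
  exact ((tfae_of_isNoetherianRing_of_isLocalRing_of_isDomain R).out 5 1).mp h1

variable {k A : Type*} [Field k] [PerfectField k] [CommRing A] [IsDomain A] [Algebra k A]
    [Algebra.Smooth k A]

theorem valuationRing_localization_of_smooth
    (ω : Ω[A⁄k]) (hω : Submodule.span A {ω} = ⊤) (P : Ideal A) [P.IsPrime] :
    ValuationRing (Localization.AtPrime P) := by
  have : IsNoetherianRing A := Algebra.FiniteType.isNoetherianRing k A
  have : IsNoetherianRing (Localization.AtPrime P) :=
    IsLocalization.isNoetherianRing P.primeCompl _ inferInstance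
  have : Algebra.FormallySmooth A (Localization.AtPrime P) :=
    Algebra.FormallySmooth.of_isLocalization P.primeCompl
  have : Algebra.FormallySmooth k (Localization.AtPrime P) :=
    Algebra.FormallySmooth.comp k A _
  have : Algebra.EssFiniteType A (Localization.AtPrime P) :=
    Algebra.EssFiniteType.of_isLocalization _ P.primeCompl
  have : Algebra.EssFiniteType k (Localization.AtPrime P) :=
    Algebra.EssFiniteType.comp k A _
  refine valuationRing_of_kaehlerDifferential_cyclic (k := k)
    (KaehlerDifferential.map k k A (Localization.AtPrime P) ω) ?_
  rw [← Set.image_singleton]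
  exact span_eq_top_of_isLocalizedModule _ P.primeCompl
    (KaehlerDifferential.map k k A (Localization.AtPrime P)) hω

theorem isIntegrallyClosed_of_smooth (ω : Ω[A⁄k]) (hω : Submodule.span A {ω} = ⊤) :
    IsIntegrallyClosed A :=
  .of_localization_maximal fun P _ _ => by
    have := valuationRing_localization_of_smooth ω hω P
    infer_instance

theorem flat_of_smooth (ω : Ω[A⁄k]) (hω : Submodule.span A {ω} = ⊤)
    (M : Type*) [AddCommGroup M] [Module A M] [Module.IsTorsionFree A M] : Module.Flat A M := by
  rw [Module.Flat.flat_iff_torsion_eq_bot_of_valuationRing_localization_isMaximal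
    fun P _ => valuationRing_localization_of_smooth ω hω P]
  exact Submodule.isTorsionFree_iff_torsion_eq_bot.mp inferInstance

end SmoothCurve

/-! ### Norms and torsion cokernels -/

section Norm

variable {A C D : Type*} [CommRing A] [IsDomain A] [CommRing C] [Algebra A C] [CommRing D]
  [Algebra A D] [Module.Free A C] [Module.Finite A C] [Module.Free A D] [Module.Finite A D]

/-- The map `φ` intertwines multiplication by `d` with multiplication by `φ d`. Its matrix has
nonzero determinant because `φ` is invertible up to the scalar `a`, so the determinant can be
cancelled. -/
theorem finrank_and_norm_eq_of_comp_eq_smul (φ : D →ₐ[A] C) (hφ : Function.Injective φ) (a : A)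
    (ha : a ≠ 0) (h : ∀ x : C, ∃ d : D, φ d = a • x) :
    Module.finrank A C = Module.finrank A D ∧
      ∀ d, Algebra.norm A (φ d) = Algebra.norm A d := by
  choose ψ hψ using h
  let Ψ : C →ₗ[A] D :=
    { toFun := ψ
      map_add' := fun x y => hφ (by simp [hψ])
      map_smul' := fun c x => hφ (by simp [hψ, smul_comm c a]) }
  have hΨ : ∀ x, φ (Ψ x) = a • x := hψ
  have hΨi : Function.Injective Ψ := fun x y hxy => by
    have : a • x = a • y := by rw [← hΨ, ← hΨ, hxy]
    exact smul_right_injective C ha this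
  have hrank : Module.finrank A C = Module.finrank A D :=
    le_antisymm (LinearMap.finrank_le_finrank_of_injective hΨi)
      (LinearMap.finrank_le_finrank_of_injective (f := φ.toLinearMap) hφ)
  refine ⟨hrank, fun d => ?_⟩
  let b := Module.finBasis A D
  let c := (Module.finBasis A C).reindex (finCongr hrank)
  -- As `φ ∘ Ψ` is multiplication by `a`, the determinants of `φ` and `Ψ` multiply to a power of
  -- `a`.
  have hdet : (LinearMap.toMatrix b c φ.toLinearMap).det ≠ 0 := by
    have h1 : φ.toLinearMap ∘ₗ Ψ = a • LinearMap.id := LinearMap.ext hΨ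
    have h2 := congrArg (fun f => (LinearMap.toMatrix c c f).det) h1
    simp only [LinearMap.toMatrix_comp c b c, Matrix.det_mul, map_smul, LinearMap.toMatrix_id,
      Matrix.det_smul, Matrix.det_one, mul_one] at h2
    intro h0
    rw [h0, zero_mul] at h2
    exact pow_ne_zero _ ha h2.symm
  have h1 : LinearMap.mulLeft A (φ d) ∘ₗ φ.toLinearMap = φ.toLinearMap ∘ₗ LinearMap.mulLeft A d :=
    LinearMap.ext fun x => by simp
  have h2 := congrArg (fun f => (LinearMap.toMatrix b c f).det) h1
  simp only [LinearMap.toMatrix_comp b c c, LinearMap.toMatrix_comp b b c, Matrix.det_mul] at h2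
  rw [mul_comm] at h2
  rw [Algebra.norm_apply, Algebra.norm_apply, ← LinearMap.det_toMatrix b,
    ← LinearMap.det_toMatrix c]
  exact mul_left_cancel₀ hdet h2

omit [IsDomain A] in
theorem norm_adjoinRoot_root (g : A[X]) (hg : g.Monic) :
    Algebra.norm A (AdjoinRoot.root g) = (-1) ^ g.natDegree * g.coeff 0 := by
  have hmin : minpoly A (AdjoinRoot.root g) = g := by
    have h0 : aeval (AdjoinRoot.root g) g = 0 := by simp
    have hint : IsIntegral A (AdjoinRoot.root g) := ⟨g, hg, by simp⟩
    refine (eq_of_monic_of_dvd_of_natDegree_le hg (minpoly.monic hint) ?_ ?_)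
    · rw [← AdjoinRoot.mk_eq_zero, ← AdjoinRoot.aeval_eq, minpoly.aeval]
    · exact natDegree_le_natDegree (minpoly.min A _ hg h0)
  have := Algebra.PowerBasis.norm_gen_eq_coeff_zero_minpoly (AdjoinRoot.powerBasis' hg)
  rwa [AdjoinRoot.powerBasis'_gen, AdjoinRoot.powerBasis'_dim, hmin] at this

end Norm

/-! ### Divisibility in normal rings and finiteness of integral extensions -/

section Algebra

/-- If the ideal of all `c` with `x ∣ c * y` were proper, it would lie in a maximal ideal `q`. In
the normal domain at `q` the divisibility of squares gives `x ∣ y`, and clearing denominators yields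
such a `c` outside `q`. The ring itself need not be a domain: `S` may be disconnected. -/
theorem dvd_of_sq_dvd_sq_of_localization {B : Type*} [CommRing B]
    (h : ∀ (q : Ideal B) [q.IsMaximal],
      IsDomain (Localization.AtPrime q) ∧ IsIntegrallyClosed (Localization.AtPrime q))
    {x y : B} (hxy : x ^ 2 ∣ y ^ 2) : x ∣ y := by
  let J : Ideal B := (Ideal.span {x}).colon {y}
  have hJ : ∀ c, c ∈ J ↔ x ∣ c * y := fun c => by
    simp [J, Submodule.mem_colon, Ideal.mem_span_singleton]
  by_contra hn
  have hJ1 : J ≠ ⊤ := fun h1 => hn (by simpa using (hJ 1).mp (h1 ▸ Submodule.mem_top))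
  obtain ⟨q, hq, hJq⟩ := Ideal.exists_le_maximal J hJ1
  obtain ⟨_, _⟩ := h q
  let R := Localization.AtPrime q
  have h1 : algebraMap B R x ∣ algebraMap B R y := by
    rw [← IsIntegrallyClosed.pow_dvd_pow_iff (n := 2) two_ne_zero, ← map_pow, ← map_pow]
    exact map_dvd _ hxy
  obtain ⟨z, hz⟩ := h1
  obtain ⟨z, s, rfl⟩ := IsLocalization.exists_mk'_eq q.primeCompl z
  have h2 : algebraMap B R (s * y) = algebraMap B R (x * z) := by
    rw [map_mul, hz, map_mul, mul_left_comm, IsLocalization.mk'_spec']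
  obtain ⟨t, ht⟩ := (IsLocalization.eq_iff_exists q.primeCompl R).mp h2
  refine (t * s).2 (hJq ((hJ _).mpr ⟨t * z, ?_⟩))
  rw [Submonoid.coe_mul, mul_assoc, ht]
  ring

/-- A dense open subset of the spectrum of an integral algebra over a domain `A` contains the
preimage of a nonempty open subset of `Spec A`. -/
theorem exists_basicOpen_subset_of_dense {A B : Type*} [CommRing A] [IsDomain A] [CommRing B]
    [IsNoetherianRing B] [Algebra A B] [Algebra.IsIntegral A B] (U : Set (PrimeSpectrum B))
    (hU : IsOpen U) (hd : Dense U) :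
    ∃ a : A, a ≠ 0 ∧ (PrimeSpectrum.basicOpen (algebraMap A B a) : Set _) ⊆ U := by
  let I := PrimeSpectrum.vanishingIdeal Uᶜ
  have hI : PrimeSpectrum.zeroLocus (I : Set B) = Uᶜ := by
    rw [PrimeSpectrum.zeroLocus_vanishingIdeal_eq_closure, hU.isClosed_compl.closure_eq]
  by_cases h : I.comap (algebraMap A B) = ⊥
  · exfalso
    -- A prime over `⊥` is minimal by incomparability, so it is the generic point of an irreducible
    -- component. In a noetherian space that component contains a nonempty open set, which meets
    -- `U`; hence its generic point lies in `U`, although `I ≤ Q` puts it in the complement.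
    obtain ⟨Q, hIQ, hQ, hQA⟩ := Ideal.exists_ideal_over_prime_of_isIntegral (⊥ : Ideal A) I h.le
    have hmin : Q ∈ minimalPrimes B := by
      refine ⟨⟨hQ, bot_le⟩, fun Q' hQ' hle => ?_⟩
      by_contra hn
      obtain ⟨x, hx, hx'⟩ := Set.not_subset.mp hn
      have := hQ'.1
      have hlt := Ideal.comap_lt_comap_of_integral_mem_sdiff (R := A) hle ⟨hx, hx'⟩
        (Algebra.IsIntegral.isIntegral x)
      rw [hQA] at hlt
      exact not_lt_bot hlt
    have hcomp : PrimeSpectrum.zeroLocus (Q : Set B) ∈ irreducibleComponents (PrimeSpectrum B) := by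
      rw [← PrimeSpectrum.zeroLocus_minimalPrimes]
      exact ⟨Q, hmin, rfl⟩
    obtain ⟨O, hO, hne, hOQ⟩ :=
      TopologicalSpace.NoetherianSpace.exists_isOpen_nonempty_subset_irreducibleComponent _ hcomp
    obtain ⟨z, hzO, hzU⟩ := hd.inter_open_nonempty O hO hne
    have hspec : (⟨Q, hQ⟩ : PrimeSpectrum B) ⤳ z := by
      rw [← PrimeSpectrum.le_iff_specializes]
      exact hOQ hzO
    have h1 : (⟨Q, hQ⟩ : PrimeSpectrum B) ∈ U := hspec.mem_open hU hzU
    have h2 : (⟨Q, hQ⟩ : PrimeSpectrum B) ∈ Uᶜ := hI ▸ hIQ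
    exact h2 h1
  · obtain ⟨a, ha, ha0⟩ := Submodule.exists_mem_ne_zero_of_ne_bot h
    refine ⟨a, ha0, fun x hx => ?_⟩
    by_contra hxU
    have : x ∈ PrimeSpectrum.zeroLocus (I : Set B) := hI ▸ hxU
    exact hx (this ha)

/-- Over the fraction field `K` of `A`, the ring `B` becomes a finite reduced algebra, that is, a
finite product of finite field extensions. So `B` embeds in the product of the integral closures of
`A` in these fields, each finite over `A` by separability in characteristic zero. -/
theorem finite_of_isIntegral_of_torsion_quotient {A B : Type*} [CommRing A] [IsDomain A]
    [CharZero A] [IsNoetherianRing A] [IsIntegrallyClosed A] [CommRing B] [IsReduced B]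
    [Algebra A B] [Algebra.IsIntegral A B] [Module.IsTorsionFree A B] (N : Submodule A B)
    (hN : N.FG) (h : ∀ x : B, ∃ a : A, a ≠ 0 ∧ a • x ∈ N) : Module.Finite A B := by
  let K := FractionRing A
  let M := Algebra.algebraMapSubmonoid B (nonZeroDivisors A)
  let L := Localization M
  have hfin : Module.Finite K L := by
    obtain ⟨T, rfl⟩ := hN
    rw [Module.finite_def, Submodule.fg_def]
    refine ⟨_, T.finite_toSet.image (algebraMap B L), ?_⟩
    refine eq_top_iff.mpr fun z _ => ?_
    obtain ⟨b, ⟨_, a, ha, rfl⟩, rfl⟩ := IsLocalization.exists_mk'_eq M z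
    obtain ⟨c, hc, hcb⟩ := h b
    have hmem : ∀ w ∈ Submodule.span A (T : Set B),
        algebraMap B L w ∈ Submodule.span K (algebraMap B L '' (T : Set B)) := fun w hw => by
      induction hw using Submodule.span_induction with
      | mem x hx => exact Submodule.subset_span ⟨x, hx, rfl⟩
      | zero => simp
      | add x y _ _ hx hy => rw [map_add]; exact add_mem hx hy
      | smul r x _ hx =>
        rw [Algebra.smul_def, map_mul, ← IsScalarTower.algebraMap_apply A B L,
          IsScalarTower.algebraMap_apply A K L, ← Algebra.smul_def]
        exact Submodule.smul_mem _ _ hx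
    have hz : (algebraMap A K (c * a)) • IsLocalization.mk' (M := M) L b ⟨algebraMap A B a, (Submonoid.mem_map_of_mem _ ha : _ ∈ M)⟩ =
        algebraMap B L (c • b) := by
      rw [Algebra.smul_def, ← IsScalarTower.algebraMap_apply A K L,
        IsScalarTower.algebraMap_apply A B L, map_mul, map_mul, mul_assoc, Algebra.smul_def,
        map_mul]
      congr 1
      exact IsLocalization.mk'_spec' (M := M) L b ⟨algebraMap A B a, (Submonoid.mem_map_of_mem _ ha : _ ∈ M)⟩
    have hne : algebraMap A K (c * a) ≠ 0 := by
      simpa [hc] using nonZeroDivisors.ne_zero ha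
    rw [← inv_smul_smul₀ hne (IsLocalization.mk' L b _), hz]
    exact Submodule.smul_mem _ _ (hmem _ hcb)
  have : IsArtinianRing L := IsArtinianRing.of_finite K L
  have : CharZero K := inferInstance
  have hfield : ∀ P : MaximalSpectrum L, Module.Finite A (integralClosure A (L ⧸ P.asIdeal)) := by
    intro P
    let := Ideal.Quotient.field P.asIdeal
    have : IsScalarTower A K (L ⧸ P.asIdeal) := .of_algebraMap_eq fun a => by
      rw [IsScalarTower.algebraMap_apply A L (L ⧸ P.asIdeal),
        IsScalarTower.algebraMap_apply A K L, ← IsScalarTower.algebraMap_apply K L (L ⧸ P.asIdeal)]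
    exact IsIntegralClosure.finite A K (L ⧸ P.asIdeal) (integralClosure A (L ⧸ P.asIdeal))
  let ev (P : MaximalSpectrum L) : B →ₐ[A] L ⧸ P.asIdeal :=
    (Ideal.Quotient.mkₐ A P.asIdeal).comp (IsScalarTower.toAlgHom A B L)
  let F : B →ₗ[A] ∀ P : MaximalSpectrum L, integralClosure A (L ⧸ P.asIdeal) :=
    LinearMap.pi fun P => ((ev P).codRestrict (integralClosure A (L ⧸ P.asIdeal)) fun b =>
      (Algebra.IsIntegral.isIntegral b).map (ev P)).toLinearMap
  refine Module.Finite.of_injective F fun x y hxy => ?_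
  have hBL : Function.Injective (algebraMap B L) := by
    refine IsLocalization.injective L (M := M) ?_
    rintro _ ⟨a, ha, rfl⟩
    rw [mem_nonZeroDivisors_iff_right]
    intro z hz
    exact (smul_eq_zero_iff_right (nonZeroDivisors.ne_zero ha)).mp
      (by rw [Algebra.smul_def, mul_comm]; exact hz)
  refine hBL ((IsArtinianRing.equivPi L).injective (funext fun P => ?_))
  exact congrArg Subtype.val (congrFun hxy P)

end Algebra

/-! ### Étaleness of double covers -/

section Etale

variable {C B : Type*} [CommRing C] [CommRing B] [Algebra C B]

theorem exists_linearMap_of_invariant (hinj : Function.Injective (algebraMap C B))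
    (f : B →ₗ[C] B) (hf : ∀ b, f b ∈ Set.range (algebraMap C B)) :
    ∃ g : B →ₗ[C] C, ∀ b, algebraMap C B (g b) = f b := by
  choose g hg using hf
  exact ⟨{ toFun := g
           map_add' := fun x y => hinj (by simp [hg])
           map_smul' := fun c x => hinj (by rw [hg, map_smul, RingHom.id_apply, smul_eq_mul, map_mul, hg, Algebra.smul_def]) }, hg⟩

/-- A double cover with involution `σ` is étale if it has anti-invariant functions without a
common zero. -/
theorem etale_of_antiInvariant (hinj : Function.Injective (algebraMap C B)) (σ : B →ₐ[C] B)
    (hσ : ∀ b, σ b = b → b ∈ Set.range (algebraMap C B)) (hσσ : ∀ b, σ (σ b) = b)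
    (h2 : IsUnit (2 : C)) (x y : B) (hx : σ x = -x) (hy : σ y = -y) (c d : C)
    (hcd : c • x ^ 2 + d • y ^ 2 = 1) : Algebra.Etale C B := by
  obtain ⟨e, he⟩ := h2.exists_left_inv
  -- With `e = 1/2`, the maps are `f₀ b = (b + σ b)/2`, `f₁ b = x (b - σ b)/2` and `f₂ b = y (b - σ
  -- b)/2`, all with invariant values. Multiplying the anti-invariant part of `b` by `c x ^ 2 + d y
  -- ^ 2 = 1` gives `b = f₀ b + c (f₁ b) x + d (f₂ b) y`.
  obtain ⟨f₀, hf₀⟩ := exists_linearMap_of_invariant hinj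
    (e • (LinearMap.id + σ.toLinearMap)) fun b => hσ _ (by simp [hσσ, add_comm])
  obtain ⟨f₁, hf₁⟩ := exists_linearMap_of_invariant hinj
    (e • (LinearMap.mulLeft C x ∘ₗ (LinearMap.id - σ.toLinearMap))) fun b =>
      hσ _ (by
        simp only [LinearMap.smul_apply, LinearMap.comp_apply, LinearMap.mulLeft_apply,
          LinearMap.sub_apply, LinearMap.id_apply, AlgHom.toLinearMap_apply, map_smul, map_mul,
          map_sub, hx, hσσ]
        congr 1
        ring)
  obtain ⟨f₂, hf₂⟩ := exists_linearMap_of_invariant hinj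
    (e • (LinearMap.mulLeft C y ∘ₗ (LinearMap.id - σ.toLinearMap))) fun b =>
      hσ _ (by
        simp only [LinearMap.smul_apply, LinearMap.comp_apply, LinearMap.mulLeft_apply,
          LinearMap.sub_apply, LinearMap.id_apply, AlgHom.toLinearMap_apply, map_smul, map_mul,
          map_sub, hy, hσσ]
        congr 1
        ring)
  simp only [LinearMap.smul_apply, LinearMap.add_apply, LinearMap.sub_apply, LinearMap.id_apply,
    AlgHom.toLinearMap_apply, LinearMap.comp_apply, LinearMap.mulLeft_apply] at hf₀ hf₁ hf₂
  have he' : algebraMap C B e * 2 = 1 := by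
    rw [← map_ofNat (algebraMap C B) 2, ← map_mul, he, map_one]
  rw [Algebra.smul_def, Algebra.smul_def] at hcd
  have key : ∀ b, b = algebraMap C B (f₀ b) + algebraMap C B (c * f₁ b) * x
      + algebraMap C B (d * f₂ b) * y := fun b => by
    rw [map_mul, map_mul, hf₀, hf₁, hf₂, Algebra.smul_def, Algebra.smul_def, Algebra.smul_def]
    linear_combination (-b) * he' - algebraMap C B e * (b - σ b) * hcd
  -- The formula `key` makes `B` a direct summand of `C ^ 3`, hence finite projective and flat.
  let F : B →ₗ[C] (C × C × C) := f₀.prod (f₁.prod f₂)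
  let G : (C × C × C) →ₗ[C] B := (Algebra.linearMap C B).coprod
    ((LinearMap.mulRight C (c • x) ∘ₗ Algebra.linearMap C B).coprod
      (LinearMap.mulRight C (d • y) ∘ₗ Algebra.linearMap C B))
  have hGF : G ∘ₗ F = LinearMap.id := LinearMap.ext fun b => by
    conv_rhs => rw [LinearMap.id_apply, key b]
    simp [G, F, Algebra.smul_def]
    ring
  have hproj : Module.Projective C B := Module.Projective.of_split F G hGF
  have hfin : Module.Finite C B :=
    Module.Finite.of_surjective G fun b => ⟨F b, DFunLike.congr_fun hGF b⟩
  have hfp : Module.FinitePresentation C B := Module.finitePresentation_of_projective C B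
  have hfpa : Algebra.FinitePresentation C B := inferInstance
  let D := KaehlerDifferential.D C B
  obtain ⟨r, hr⟩ := hσ (x * y) (by simp [hx, hy])
  obtain ⟨r₁, hr₁⟩ := hσ (x * x) (by simp [hx])
  obtain ⟨r₂, hr₂⟩ := hσ (y * y) (by simp [hy])
  -- It remains to kill `Ω[B⁄C]`. The products `x * x`, `y * y`, `x * y` are invariant, so their
  -- differentials vanish; dividing by 2 and using `c x ^ 2 + d y ^ 2 = 1` gives `D x = D y = 0`.
  have half : ∀ w : Ω[B⁄C], w + w = 0 → w = 0 := fun w hw => by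
    have h1 : (algebraMap C B e * 2) • w = 0 := by rw [mul_smul, two_smul, hw, smul_zero]
    rwa [he', one_smul] at h1
  have hxx : x • D x = 0 := half _ (by rw [← D.leibniz, ← hr₁, D.map_algebraMap])
  have hyy : y • D y = 0 := half _ (by rw [← D.leibniz, ← hr₂, D.map_algebraMap])
  have hxy : x • D y + y • D x = 0 := by rw [← D.leibniz, ← hr, D.map_algebraMap]
  have hDx : D x = 0 := by
    have h1 : y ^ 2 • D x = 0 := by
      have : y ^ 2 • D x = y • (x • D y + y • D x) - x • y • D y := by
        rw [smul_add, smul_smul, smul_smul, smul_smul, mul_comm y x, ← sq, add_sub_cancel_left]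
      rw [this, hxy, hyy, smul_zero, smul_zero, sub_zero]
    rw [← one_smul B (D x), ← hcd, add_smul, mul_smul, mul_smul, h1, sq, mul_smul, hxx]
    simp
  have hDy : D y = 0 := by
    have h1 : x ^ 2 • D y = 0 := by
      have : x ^ 2 • D y = x • (x • D y + y • D x) - y • x • D x := by
        rw [smul_add, smul_smul, smul_smul, smul_smul, mul_comm y x, ← sq, add_sub_cancel_right]
      rw [this, hxy, hxx, smul_zero, smul_zero, sub_zero]
    rw [← one_smul B (D y), ← hcd, add_smul, mul_smul, mul_smul, h1, sq, mul_smul, hyy]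
    simp
  have hunr : Algebra.FormallyUnramified C B := by
    refine ⟨?_⟩
    rw [← Submodule.subsingleton_iff B, ← subsingleton_iff_bot_eq_top,
      ← KaehlerDifferential.span_range_derivation, eq_comm, Submodule.span_eq_bot]
    rintro _ ⟨b, rfl⟩
    change D b = 0
    rw [key b, D.map_add, D.map_add, D.leibniz, D.leibniz, D.map_algebraMap, D.map_algebraMap,
      D.map_algebraMap, hDx, hDy]
    simp
  exact Algebra.Etale.of_formallyUnramified_of_flat

end Etale

/-- `B` is a torsion-free `A`-algebra, and up to torsion it is generated by the element `lam`, with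
the single relation `g(lam ^ 2) = 0`. -/
structure SpectralModel {A B : Type*} [CommRing A] [CommRing B] [Algebra A B] (g : A[X])
    (lam : B) : Prop where
  monic : g.Monic
  aeval_sq : aeval (lam ^ 2) g = 0
  dvd_of_aeval : ∀ r : A[X], aeval lam r = 0 → expand A 2 g ∣ r
  torsion : ∀ z : B, ∃ c : A, c ≠ 0 ∧ ∃ r : A[X], c • z = aeval lam r
  isTorsionFree : Module.IsTorsionFree A B

theorem exists_aeval_eq_even_add_odd {A B : Type*} [CommRing A] [CommRing B] [Algebra A B] (x : B)
    (r : A[X]) : ∃ r₀ r₁ : A[X], aeval x r = aeval (x ^ 2) r₀ + x * aeval (x ^ 2) r₁ := by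
  induction r using Polynomial.induction_on' with
  | add p q hp hq =>
    obtain ⟨p₀, p₁, hp⟩ := hp
    obtain ⟨q₀, q₁, hq⟩ := hq
    exact ⟨p₀ + q₀, p₁ + q₁, by simp only [map_add, hp, hq]; ring⟩
  | monomial n a =>
    obtain ⟨k, rfl | rfl⟩ := Nat.even_or_odd' n
    · exact ⟨monomial k a, 0, by simp [aeval_monomial, pow_mul]⟩
    · exact ⟨0, monomial k a, by simp [aeval_monomial, pow_mul, pow_succ]; ring⟩

/-! ### Algebra of the local model: the cofactor `p / lam` and norms -/

namespace SpectralModel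

variable {A B : Type*} [CommRing A] [IsDomain A] [CommRing B] [Algebra A B] {g : A[X]} {lam : B}

theorem smul_injective (h : SpectralModel g lam) {c : A} (hc : c ≠ 0) {x y : B}
    (hxy : c • x = c • y) : x = y :=
  have := h.isTorsionFree
  smul_right_injective B hc hxy

/-- On polynomials in `lam` this is `-(-lam) = lam`; every other element has a nonzero multiple of
that form, and `B` is torsion-free. -/
theorem involutive (h : SpectralModel g lam) (σ : B →ₐ[A] B) (hσ : σ lam = -lam) (b : B) :
    σ (σ b) = b := by
  obtain ⟨c, hc, r, hr⟩ := h.torsion b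
  refine h.smul_injective hc ?_
  rw [← map_smul, ← map_smul, hr, ← aeval_algHom_apply, ← aeval_algHom_apply, hσ, map_neg, hσ,
    neg_neg]

theorem torsion_of_invariant (h : SpectralModel g lam) (h2 : (2 : A) ≠ 0) (σ : B →ₐ[A] B)
    (hσ : σ lam = -lam) (b : B) (hb : σ b = b) :
    ∃ c : A, c ≠ 0 ∧ ∃ r : A[X], c • b = aeval (lam ^ 2) r := by
  obtain ⟨c, hc, r, hr⟩ := h.torsion b
  obtain ⟨r₀, r₁, hr₀₁⟩ := exists_aeval_eq_even_add_odd lam r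
  -- Adding `c • b` to its own image under `σ` cancels the odd part of the polynomial and gives
  -- twice the even part.
  refine ⟨c, hc, r₀, h.smul_injective h2 ?_⟩
  have h1 := congrArg σ hr
  rw [map_smul, hb, hr₀₁, map_add, map_mul, ← aeval_algHom_apply, ← aeval_algHom_apply, map_pow,
    hσ, neg_sq] at h1
  rw [hr₀₁] at hr
  rw [two_smul, two_smul]
  nth_rewrite 1 [hr]
  rw [h1]
  ring

theorem dvd_of_aeval_sq (h : SpectralModel g lam) (r : A[X]) (hr : aeval (lam ^ 2) r = 0) :
    g ∣ r := by
  rw [← modByMonic_eq_zero_iff_dvd h.monic]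
  have h1 : aeval (lam ^ 2) (r %ₘ g) = 0 := by
    rw [modByMonic_eq_sub_mul_div, map_sub, map_mul, hr, h.aeval_sq, zero_mul, sub_zero]
  have h2 : expand A 2 g ∣ expand A 2 (r %ₘ g) :=
    h.dvd_of_aeval _ (by rw [expand_aeval, h1])
  by_contra hne
  have h3 : expand A 2 (r %ₘ g) ≠ 0 := by rwa [Ne, expand_eq_zero two_pos]
  have h4 := natDegree_le_of_dvd h2 h3
  rw [natDegree_expand, natDegree_expand] at h4
  -- The remainder has degree strictly less than that of `g` only for `g ≠ 1`; for `g = 1` it is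
  -- zero.
  have h5 : g ≠ 1 := fun h1 => hne (by rw [h1, modByMonic_one])
  have := natDegree_modByMonic_lt r h.monic h5
  omega

theorem finite [CharZero A] [IsNoetherianRing A] [IsIntegrallyClosed A] [IsReduced B]
    [Algebra.IsIntegral A B] (h : SpectralModel g lam) : Module.Finite A B := by
  have := h.isTorsionFree
  refine finite_of_isIntegral_of_torsion_quotient (Subalgebra.toSubmodule (Algebra.adjoin A {lam}))
    (Algebra.IsIntegral.isIntegral lam).fg_adjoin_singleton fun x => ?_
  obtain ⟨c, hc, r, hr⟩ := h.torsion x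
  exact ⟨c, hc, hr ▸ aeval_mem_adjoin_singleton A lam⟩

/-- By the equation `g(lam ^ 2) = 0`, the element `lam` divides `p ^ 2`, which is a nonzero scalar
on a torsion-free module. -/
theorem smul_eq_zero_of_mul (h : SpectralModel g lam) {p : A} (hp : p ≠ 0)
    (hg0 : g.coeff 0 = p ^ 2) {z : B} (hz : lam * z = 0) : z = 0 := by
  refine h.smul_injective (pow_ne_zero 2 hp) ?_
  have h1 : aeval (lam ^ 2) g = aeval (lam ^ 2) g.divX * lam ^ 2 + algebraMap A B (p ^ 2) := by
    conv_lhs => rw [← divX_mul_X_add g]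
    simp [hg0]
  rw [h.aeval_sq] at h1
  rw [smul_zero, Algebra.smul_def]
  linear_combination (-z) * h1 - aeval (lam ^ 2) g.divX * lam * hz

/-- The function `y = p / lam` on the normalization. -/
theorem exists_cofactor (h : SpectralModel g lam) {p : A} (hp : p ≠ 0) (hg0 : g.coeff 0 = p ^ 2)
    (hg1 : IsCoprime (g.coeff 1) p) (hB : ∀ (q : Ideal B) [q.IsMaximal],
      IsDomain (Localization.AtPrime q) ∧ IsIntegrallyClosed (Localization.AtPrime q)) :
    ∃ y : B, lam * y = algebraMap A B p ∧
      ∃ c ∈ Algebra.adjoin A {lam ^ 2, y ^ 2}, ∃ d ∈ Algebra.adjoin A {lam ^ 2, y ^ 2},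
        c * lam ^ 2 + d * y ^ 2 = 1 := by
  have h1 : aeval (lam ^ 2) g = (aeval (lam ^ 2) g.divX.divX * lam ^ 2
      + algebraMap A B (g.coeff 1)) * lam ^ 2 + algebraMap A B (p ^ 2) := by
    conv_lhs => rw [← divX_mul_X_add g, ← divX_mul_X_add g.divX]
    simp [hg0, coeff_divX]
  rw [h.aeval_sq] at h1
  set k := aeval (lam ^ 2) g.divX.divX
  have hdvd : lam ^ 2 ∣ algebraMap A B p ^ 2 :=
    ⟨-(k * lam ^ 2 + algebraMap A B (g.coeff 1)), by rw [← map_pow]; linear_combination -h1⟩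
  obtain ⟨y, hy⟩ := dvd_of_sq_dvd_sq_of_localization hB hdvd
  -- Multiplied by `lam ^ 2`, this is the spectral equation; `lam` is then cancelled twice.
  have hy2 : y ^ 2 = -(k * lam ^ 2 + algebraMap A B (g.coeff 1)) := by
    rw [← sub_eq_zero]
    refine h.smul_eq_zero_of_mul hp hg0 (h.smul_eq_zero_of_mul hp hg0 ?_)
    rw [map_pow, hy] at h1
    linear_combination -h1
  -- Put `p ^ 2 = lam ^ 2 y ^ 2` and `g.coeff 1 = -y ^ 2 - k lam ^ 2` into `u * g.coeff 1 + v * p ^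
  -- 2 = 1` and collect the multiples of `lam ^ 2` and `y ^ 2`. The coefficients are polynomials in
  -- these two squares, so they will be invariant.
  obtain ⟨u, v, huv⟩ := (IsCoprime.pow_right (n := 2) hg1)
  have huv' := congrArg (algebraMap A B) huv
  simp only [map_add, map_mul, map_one, map_pow, hy] at huv'
  have hk : k ∈ Algebra.adjoin A {lam ^ 2, y ^ 2} :=
    Algebra.adjoin_mono (by simp) (aeval_mem_adjoin_singleton A (lam ^ 2))
  refine ⟨y, hy.symm, -algebraMap A B u * k + algebraMap A B v * y ^ 2, ?_, -algebraMap A B u, ?_, ?_⟩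
  · have hm := Algebra.subset_adjoin (R := A) (s := {lam ^ 2, y ^ 2}) (Set.mem_insert_of_mem _ rfl)
    exact add_mem (mul_mem (neg_mem (Subalgebra.algebraMap_mem _ _)) hk)
      (mul_mem (Subalgebra.algebraMap_mem _ _) hm)
  · exact neg_mem (Subalgebra.algebraMap_mem _ _)
  · linear_combination huv' - algebraMap A B u * hy2

theorem map_cofactor (h : SpectralModel g lam) {p : A} (hp : p ≠ 0) (hg0 : g.coeff 0 = p ^ 2)
    {y : B} (hy : lam * y = algebraMap A B p) (σ : B →ₐ[A] B) (hσ : σ lam = -lam) :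
    σ y = -y := by
  rw [← sub_eq_zero]
  refine h.smul_eq_zero_of_mul hp hg0 ?_
  have := congrArg σ hy
  rw [map_mul, hσ, σ.commutes, ← hy] at this
  linear_combination -this

section Norm

variable {C : Type*} [CommRing C] [Algebra A C] [Algebra C B] [IsScalarTower A C B]
  [Module.Free A C] [Module.Finite A C]

/-- The map `A[t]/(g) → C`, `t ↦ s`, is injective with torsion cokernel, because an invariant
function is, up to torsion, a polynomial in `lam ^ 2`. Rank and norm are therefore those of
`A[t]/(g)`. -/
theorem finrank_and_norm (h : SpectralModel g lam) (h2 : (2 : A) ≠ 0) (σ : B →ₐ[A] B)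
    (hσ : σ lam = -lam) (hinj : Function.Injective (algebraMap C B))
    (hC : ∀ c : C, σ (algebraMap C B c) = algebraMap C B c) (s : C)
    (hs : algebraMap C B s = lam ^ 2) :
    Module.finrank A C = g.natDegree ∧ Algebra.norm A s = (-1) ^ g.natDegree * g.coeff 0 := by
  have := h.isTorsionFree
  have := h.monic.free_adjoinRoot
  have := h.monic.finite_adjoinRoot
  have hs0 : aeval s g = 0 := hinj (by
    rw [map_zero, ← aeval_algebraMap_apply, hs, h.aeval_sq])
  let φ : AdjoinRoot g →ₐ[A] C := AdjoinRoot.liftAlgHom g (Algebra.ofId A C) s hs0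
  have hφ : ∀ r : A[X], φ (AdjoinRoot.mk g r) = aeval s r := fun r => by
    simp [φ, aeval_def]; rfl
  have hφi : Function.Injective φ := by
    rw [injective_iff_map_eq_zero]
    intro x hx
    obtain ⟨r, rfl⟩ := AdjoinRoot.mk_surjective x
    rw [hφ] at hx
    rw [AdjoinRoot.mk_eq_zero]
    refine h.dvd_of_aeval_sq r ?_
    rw [← hs, aeval_algebraMap_apply, hx, map_zero]
  have hloc : ∀ x : C, ∃ c : A, c ≠ 0 ∧ c • x ∈ LinearMap.range φ.toLinearMap := fun x => by
    obtain ⟨c, hc, r, hr⟩ := h.torsion_of_invariant h2 σ hσ _ (hC x)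
    refine ⟨c, hc, AdjoinRoot.mk g r, ?_⟩
    refine hinj ?_
    rw [AlgHom.toLinearMap_apply, hφ, ← aeval_algebraMap_apply, hs, ← hr, Algebra.smul_def,
      Algebra.smul_def, map_mul, ← IsScalarTower.algebraMap_apply]
  classical
  -- As `C` is finite over `A`, the product of the denominators of finitely many generators works
  -- for every element.
  have hglob : ∃ a : A, a ≠ 0 ∧ ∀ x : C, a • x ∈ LinearMap.range φ.toLinearMap := by
    obtain ⟨T, hT⟩ := Module.Finite.fg_top (R := A) (M := C)
    choose c hc hcx using hloc
    refine ⟨∏ t ∈ T, c t, Finset.prod_ne_zero_iff.mpr fun t _ => hc t, fun x => ?_⟩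
    have hx : x ∈ Submodule.span A (T : Set C) := hT ▸ Submodule.mem_top
    induction hx using Submodule.span_induction with
    | mem t ht =>
      rw [← Finset.prod_erase_mul T c ht, mul_smul]
      exact Submodule.smul_mem _ _ (hcx t)
    | zero => simp
    | add x y _ _ hx hy => rw [smul_add]; exact add_mem hx hy
    | smul r x _ hx => rw [smul_comm]; exact Submodule.smul_mem _ _ hx
  obtain ⟨a, ha, hax⟩ := hglob
  obtain ⟨hr, hn⟩ := finrank_and_norm_eq_of_comp_eq_smul φ hφi a ha hax
  refine ⟨?_, ?_⟩
  · rw [hr, (AdjoinRoot.powerBasis' h.monic).finrank, AdjoinRoot.powerBasis'_dim]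
  · have h1 : φ (AdjoinRoot.root g) = s := by simpa using hφ X
    rw [← h1, hn, norm_adjoinRoot_root g h.monic]

/-- The heart of the norm computation. From `z ^ 2 = v * s` and the norm of `s = lam ^ 2`, the
square of `Nm(z)` is divisible by `p ^ 2`, so `p ∣ Nm(z)` in the integrally closed ring `A`. The
formula for `n ^ 2` will show that `n` is a unit when `l` is. -/
theorem norm_antiInvariant (h : SpectralModel g lam) (h2 : (2 : A) ≠ 0) [IsIntegrallyClosed A]
    {p : A} (hp : p ≠ 0) (hg0 : g.coeff 0 = p ^ 2) (σ : B →ₐ[A] B)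
    (hσ : σ lam = -lam) (hinj : Function.Injective (algebraMap C B))
    (hC : ∀ c : C, σ (algebraMap C B c) = algebraMap C B c) (s z v : C) (l : B)
    (hs : algebraMap C B s = lam ^ 2) (hz : algebraMap C B z = l * lam)
    (hv : algebraMap C B v = l ^ 2) :
    ∃ n : A, Algebra.norm A z = p * n ∧ n ^ 2 = (-1) ^ g.natDegree * Algebra.norm A v := by
  have hzz : z ^ 2 = v * s := hinj (by rw [map_pow, map_mul, hz, hv, hs, mul_pow])
  have hN := congrArg (Algebra.norm A) hzz
  rw [map_pow, map_mul, (h.finrank_and_norm h2 σ hσ hinj hC s hs).2, hg0] at hN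
  have hdvd : p ^ 2 ∣ Algebra.norm A z ^ 2 :=
    ⟨(-1) ^ g.natDegree * Algebra.norm A v, by rw [hN]; ring⟩
  obtain ⟨n, hn⟩ := (IsIntegrallyClosed.pow_dvd_pow_iff two_ne_zero).mp hdvd
  refine ⟨n, hn, mul_left_cancel₀ (pow_ne_zero 2 hp) ?_⟩
  rw [← mul_pow, ← hn, hN]
  ring

end Norm

end SpectralModel

/-! ### Existence and restriction of frames -/

variable {X : Scheme.{0}} (s : X ⟶ Spec (CommRingCat.of ℂ))

theorem eq_top_of_mem_specComplex (U : (Spec (CommRingCat.of ℂ)).Opens)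
    {x : Spec (CommRingCat.of ℂ)} (hx : x ∈ U) : U = ⊤ :=
  eq_top_iff.mpr fun y _ => by
    have : Subsingleton (Spec (CommRingCat.of ℂ)) :=
      inferInstanceAs (Subsingleton (PrimeSpectrum ℂ))
    rwa [Subsingleton.elim y x]

theorem bijective_smul_of_basis {R M : Type*} [CommRing R] [AddCommGroup M] [Module R M]
    (b : Module.Basis Unit R M) : Function.Bijective fun r : R => r • b () := by
  constructor
  · intro r r' h
    have h1 := DFunLike.congr_fun (congrArg b.repr h) ()
    simpa only [map_smul, Module.Basis.repr_self, Finsupp.smul_apply, Finsupp.single_eq_same,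
      smul_eq_mul, mul_one] using h1
  · intro w
    exact ⟨b.repr w (), by simpa using b.sum_repr w⟩

theorem exists_basis_of_bijective_smul {R M : Type*} [CommRing R] [AddCommGroup M] [Module R M]
    (w : M) (h : Function.Bijective fun r : R => r • w) : ∃ b : Module.Basis Unit R M, b () = w :=
  let e : R ≃ₗ[R] M := LinearEquiv.ofBijective (LinearMap.toSpanSingleton R M w) h
  ⟨(Module.Basis.singleton Unit R).map e, by
    rw [Module.Basis.map_apply, Module.Basis.singleton_apply]; exact one_smul R w⟩

theorem exists_frame [SmoothOfRelativeDimension 1 s] (x : X) :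
    ∃ U : X.affineOpens, x ∈ U.1 ∧ Nonempty (Frame s U.1) := by
  obtain ⟨U₀, _, V, hV, hx, e, h⟩ :=
    SmoothOfRelativeDimension.exists_isStandardSmoothOfRelativeDimension (n := 1) (f := s) x
  obtain rfl := eq_top_of_mem_specComplex U₀ (e hx)
  refine ⟨⟨V, hV⟩, hx, ?_⟩
  have : Nonempty V := ⟨⟨x, hx⟩⟩
  have : Nontrivial Γ(X, V) := inferInstance
  let := (structureMap s V).hom.toAlgebra
  have : Algebra.IsStandardSmoothOfRelativeDimension 1
    Γ(Spec (CommRingCat.of ℂ), ⊤) Γ(X, V) := h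
  have := Algebra.IsStandardSmoothOfRelativeDimension.isStandardSmooth 1 (R := Γ(Spec (CommRingCat.of ℂ), ⊤)) (S := Γ(X, V))
  have hr := Algebra.IsStandardSmoothOfRelativeDimension.rank_kaehlerDifferential
    (R := Γ(Spec (CommRingCat.of ℂ), ⊤)) (S := Γ(X, V)) 1
  have : Module.Free Γ(X, V) Ω[Γ(X, V)⁄Γ(Spec (CommRingCat.of ℂ), ⊤)] := inferInstance
  let b := Module.basisUnique Unit (Module.finrank_eq_of_rank_eq hr)
  refine ⟨⟨b (), ?_⟩⟩
  exact bijective_smul_of_basis b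

theorem resDifferential_bijective {U : X.affineOpens} (f : Γ(X, U.1)) (ω : Frame s U.1) :
    Function.Bijective fun r : Γ(X, X.basicOpen f) =>
      r • resDifferential s (X.basicOpen_le f) ω.form := by
  have : IsLocalization.Away f Γ(X, X.basicOpen f) := U.2.isLocalization_basicOpen f
  let := (structureMap s U.1).hom.toAlgebra
  let := (structureMap s (X.basicOpen f)).hom.toAlgebra
  let k := Γ(Spec (CommRingCat.of ℂ), ⊤)
  let A := Γ(X, U.1)
  let B := Γ(X, X.basicOpen f)
  have : IsScalarTower k A B := .of_algebraMap_eq' (by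
    have := structureMap_res s (X.basicOpen_le f)
    rw [Category.id_comp] at this
    exact congrArg CommRingCat.Hom.hom this)
  let L : Ω[A⁄k] →ₗ[A] Ω[B⁄k] := KaehlerDifferential.map k k A B
  have hL : resDifferential s (X.basicOpen_le f) ω.form = L ω.form := rfl
  obtain ⟨b, hb⟩ : ∃ b : Module.Basis Unit A Ω[A⁄k], b () = ω.form :=
    exists_basis_of_bijective_smul ω.form ω.bijective
  have h := bijective_smul_of_basis (b.ofIsLocalizedModule B (Submonoid.powers f) L)
  rw [Module.Basis.ofIsLocalizedModule_apply, hb] at h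
  exact h

/-- The restriction of a frame to a basic open subset. -/
def Frame.restrict {U : X.affineOpens} (ω : Frame s U.1) (f : Γ(X, U.1)) :
    Frame s (X.basicOpen f) where
  form := resDifferential s (X.basicOpen_le f) ω.form
  bijective := resDifferential_bijective s f ω

/-! ### Coordinate rings of affine open subsets with a frame -/

/-- Being a field is a proposition about `k` here, so that the lemma applies to `Γ(Spec ℂ, ⊤)` with
its given ring structure. -/
theorem smooth_coordinateRing {k A : Type*} [CommRing k] [CommRing A] [IsDomain A] [Algebra k A]
    (hk : IsField k) [CharZero k] [Algebra.Smooth k A] (ω : Ω[A⁄k])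
    (hω : Submodule.span A {ω} = ⊤) :
    IsNoetherianRing A ∧ IsIntegrallyClosed A ∧
      ∀ (M : Type) [AddCommGroup M] [Module A M] [Module.IsTorsionFree A M], Module.Flat A M := by
  let := hk.toField
  exact ⟨Algebra.FiniteType.isNoetherianRing k A, isIntegrallyClosed_of_smooth ω hω,
    fun M _ _ _ => flat_of_smooth ω hω M⟩

theorem isField_Γ_specComplex : IsField Γ(Spec (CommRingCat.of ℂ), ⊤) :=
  (Scheme.ΓSpecIso (CommRingCat.of ℂ)).commRingCatIsoToRingEquiv.toMulEquiv.isField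
    (Field.toIsField ℂ)

instance charZero_Γ_specComplex : CharZero Γ(Spec (CommRingCat.of ℂ), ⊤) :=
  (Scheme.ΓSpecIso (CommRingCat.of ℂ)).commRingCatIsoToRingEquiv.symm.toRingHom.charZero_iff
    (Scheme.ΓSpecIso (CommRingCat.of ℂ)).commRingCatIsoToRingEquiv.symm.injective |>.mp
      inferInstance

theorem Frame.coordinateRing [IsIntegral X] [Smooth s] (U : X.affineOpens) [Nonempty U.1]
    (ω : Frame s U.1) :
    IsNoetherianRing Γ(X, U.1) ∧ IsIntegrallyClosed Γ(X, U.1) ∧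
      ∀ (M : Type) [AddCommGroup M] [Module Γ(X, U.1) M] [Module.IsTorsionFree Γ(X, U.1) M],
        Module.Flat Γ(X, U.1) M := by
  let := (structureMap s U.1).hom.toAlgebra
  have : Algebra.Smooth Γ(Spec (CommRingCat.of ℂ), ⊤) Γ(X, U.1) :=
    HasRingHomProperty.appLE @Smooth s inferInstance ⟨⊤, isAffineOpen_top _⟩ U le_top
  refine smooth_coordinateRing isField_Γ_specComplex (ω.form : Ω[_⁄_]) ?_
  exact eq_top_iff.mpr fun w _ => Submodule.mem_span_singleton.mpr (ω.bijective.2 w)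

include s in
theorem isUnit_natCast (U : X.Opens) (n : ℕ) (hn : n ≠ 0) : IsUnit (n : Γ(X, U)) := by
  let := isField_Γ_specComplex.toField
  have h : IsUnit (n : Γ(Spec (CommRingCat.of ℂ), ⊤)) := (Nat.cast_ne_zero.mpr hn).isUnit
  simpa using h.map (structureMap s U).hom

include s in
theorem charZero_of_nonempty (U : X.Opens) [Nonempty U] : CharZero Γ(X, U) :=
  charZero_of_inj_zero fun n hn => by
    by_contra h
    exact not_isUnit_zero (hn ▸ isUnit_natCast s U n h)

theorem Frame.exists_restrict {U : X.affineOpens} (ω : Frame s U.1) {V : X.Opens} (h : V ≤ U.1)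
    (hV : ∃ f : Γ(X, U.1), V = X.basicOpen f) :
    ∃ ω' : Frame s V, ω'.form = resDifferential s h ω.form := by
  obtain ⟨f, rfl⟩ := hV
  exact ⟨ω.restrict s f, rfl⟩

/-! ### Zeros of canonical sections and coefficients of the spectral polynomial -/

variable {s}

/-- One frame suffices to test vanishing. On a common basic open subset, the coefficient in any
other frame is `u ^ n` times the given one, so if it were a unit at `x`, the given one would be too.
-/
theorem CanonicalSection.vanishesAt_of_not_isUnit {n : ℕ} (c : CanonicalSection s n) {x : X}
    (U : X.affineOpens) (ω : Frame s U.1) (hx : x ∈ U.1)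
    (h : ¬ IsUnit (X.presheaf.germ U.1 x hx (c.coeff U ω))) : c.VanishesAt x := by
  intro V ω' hx'
  rw [IsLocalRing.mem_maximalIdeal, mem_nonunits_iff]
  intro hu
  obtain ⟨f, g, hfg, hxf⟩ := exists_basicOpen_le_affine_inter U.2 V.2 x ⟨hx, hx'⟩
  let W : X.affineOpens := ⟨X.basicOpen f, U.2.basicOpen f⟩
  have hWU : W.1 ≤ U.1 := X.basicOpen_le f
  have hWV : W.1 ≤ V.1 := hfg.trans_le (X.basicOpen_le g)
  obtain ⟨ω'', hω''⟩ := ω'.exists_restrict s hWV ⟨g, hfg⟩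
  obtain ⟨u, hu'⟩ := ω''.bijective.2 (resDifferential s hWU ω.form)
  have h1 := c.coeff_res V W hWV ω' ω'' 1 (by rw [one_smul, hω''])
  have h2 := c.coeff_res U W hWU ω ω'' u hu'.symm
  rw [one_pow, one_mul] at h1
  refine h (isUnit_of_mul_isUnit_right (x := X.presheaf.germ W.1 x hxf (u ^ n)) ?_)
  rw [← X.presheaf.germ_res_apply (homOfLE hWU) x hxf, ← map_mul]
  rw [← X.presheaf.germ_res_apply (homOfLE hWV) x hxf, ← h1, h2] at hu
  exact hu

theorem CanonicalSection.HasSimpleZeros.coeff_ne_zero {n : ℕ} {c : CanonicalSection s n}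
    (hc : c.HasSimpleZeros) (U : X.affineOpens) [hU : Nonempty U.1] (ω : Frame s U.1) :
    c.coeff U ω ≠ 0 := fun h => by
  obtain ⟨x, hx⟩ := hU
  exact hc x U ω hx (by rw [h, map_zero]; exact zero_mem _)

/-- The polynomial `g` with `g(t ^ 2)` the spectral polynomial. -/
def quotientPolynomial (m : ℕ) (b : ∀ i : ℕ, CanonicalSection s (2 * i))
    (pm : CanonicalSection s m) (U : X.affineOpens) (ω : Frame s U.1) : Γ(X, U.1)[X] :=
  Polynomial.X ^ m + ∑ i ∈ Finset.Ico 1 m, C ((b i).coeff U ω) * Polynomial.X ^ (m - i)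
    + C (pm.coeff U ω ^ 2)

section QuotientPolynomial

variable (m : ℕ) (b : ∀ i : ℕ, CanonicalSection s (2 * i))
    (pm : CanonicalSection s m) (U : X.affineOpens) (ω : Frame s U.1)

theorem expand_quotientPolynomial :
    expand _ 2 (quotientPolynomial m b pm U ω) = spectralPolynomial m b pm U ω := by
  simp [quotientPolynomial, spectralPolynomial, pow_mul]

theorem quotientPolynomial_natDegree_monic [Nontrivial Γ(X, U.1)] (hm : 1 ≤ m) :
    (quotientPolynomial m b pm U ω).natDegree = m ∧ (quotientPolynomial m b pm U ω).Monic := by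
  have hdeg : (∑ i ∈ Finset.Ico 1 m, C ((b i).coeff U ω) * Polynomial.X ^ (m - i)
      + C (pm.coeff U ω ^ 2) : Γ(X, U.1)[X]).degree < m := by
    refine (degree_add_le _ _).trans_lt (max_lt ?_ ?_)
    · refine (degree_sum_le _ _).trans_lt ((Finset.sup_lt_iff (WithBot.bot_lt_coe m)).mpr ?_)
      intro i hi
      rw [Finset.mem_Ico] at hi
      refine (degree_C_mul_X_pow_le _ _).trans_lt ?_
      exact WithBot.coe_lt_coe.mpr (by omega : m - i < m)
    · exact degree_C_le.trans_lt (by exact_mod_cast hm)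
  rw [quotientPolynomial, add_assoc]
  refine ⟨?_, monic_X_pow_add hdeg⟩
  exact natDegree_eq_of_degree_eq_some ((degree_add_eq_left_of_degree_lt
    (by rwa [degree_X_pow])).trans (degree_X_pow m))

theorem quotientPolynomial_coeff_zero (hm : 1 ≤ m) :
    (quotientPolynomial m b pm U ω).coeff 0 = pm.coeff U ω ^ 2 := by
  have h : ∀ i ∈ Finset.Ico 1 m, (C ((b i).coeff U ω) * Polynomial.X ^ (m - i)).coeff 0 = 0 :=
    fun i hi => by
      rw [Finset.mem_Ico] at hi
      simp [coeff_X_pow, show 0 ≠ m - i by omega]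
  simp only [quotientPolynomial, coeff_add, finsetSum_coeff, Finset.sum_eq_zero h, coeff_X_pow,
    coeff_C_zero, if_neg (show 0 ≠ m by omega), zero_add]

theorem quotientPolynomial_coeff_one (hm : 2 ≤ m) :
    (quotientPolynomial m b pm U ω).coeff 1 = (b (m - 1)).coeff U ω := by
  have h : ∀ i ∈ Finset.Ico 1 m, i ≠ m - 1 →
      (C ((b i).coeff U ω) * Polynomial.X ^ (m - i)).coeff 1 = 0 := fun i hi hi' => by
    rw [Finset.mem_Ico] at hi
    simp [coeff_X_pow, show 1 ≠ m - i by omega]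
  simp only [quotientPolynomial, coeff_add, finsetSum_coeff]
  rw [Finset.sum_eq_single_of_mem (m - 1) (Finset.mem_Ico.mpr (by omega)) h, coeff_X_pow,
    if_neg (by omega), coeff_C_mul, coeff_X_pow, if_pos (by omega), coeff_C_of_ne_zero one_ne_zero]
  ring

/-- For `m = 1` the coefficient of `t` is the leading coefficient `1`. For `m ≥ 2` it is `b_{2m-2}`,
and the absence of common zeros with `p_m` says that the two basic opens cover the affine open `U`.
-/
theorem isCoprime_coeff_one (hm : 1 ≤ m)
    (hb : 2 ≤ m → ∀ x : X, pm.VanishesAt x → ¬ (b (m - 1)).VanishesAt x) :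
    IsCoprime ((quotientPolynomial m b pm U ω).coeff 1) (pm.coeff U ω) := by
  obtain rfl | hm' := hm.eq_or_lt
  · have : (quotientPolynomial 1 b pm U ω).coeff 1 = 1 := by
      rw [quotientPolynomial, coeff_add, coeff_C_of_ne_zero one_ne_zero]
      simp
    rw [this]
    exact isCoprime_one_left
  · rw [quotientPolynomial_coeff_one m b pm U ω hm', ← Ideal.isCoprime_span_singleton_iff,
      Ideal.isCoprime_iff_sup_eq, ← Ideal.span_union,
      ← IsAffineOpen.iSup_basicOpen_eq_self_iff U.2]
    refine le_antisymm (iSup_le fun f => X.basicOpen_le _) fun x hx => ?_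
    rw [TopologicalSpace.Opens.mem_iSup]
    by_contra hn
    rw [not_exists] at hn
    refine hb hm' x (pm.vanishesAt_of_not_isUnit U ω hx fun h => ?_)
      ((b (m - 1)).vanishesAt_of_not_isUnit U ω hx fun h => ?_)
    · exact hn ⟨_, Or.inr rfl⟩ ((X.mem_basicOpen _ x hx).mpr h)
    · exact hn ⟨_, Or.inl rfl⟩ ((X.mem_basicOpen _ x hx).mpr h)

end QuotientPolynomial

/-! ### Functions under a birational morphism -/

theorem bijective_app_of_isIso_morphismRestrict {S S' : Scheme.{0}} (μ : S ⟶ S') (V : S'.Opens)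
    [IsIso (μ ∣_ V)] (O : S'.Opens) (hO : O ≤ V) : Function.Bijective (μ.app O) := by
  have key : ∀ T (hT : T = μ ⁻¹ᵁ O) (e : T ≤ μ ⁻¹ᵁ O), IsIso (μ.appLE O T e) → IsIso (μ.app O) := by
    rintro _ rfl e h
    rwa [Scheme.Hom.appLE_eq_app] at h
  have h1 : IsIso ((μ ∣_ V).app (V.ι ⁻¹ᵁ O)) := inferInstance
  rw [morphismRestrict_app'] at h1
  obtain ⟨O, rfl⟩ : ∃ O', V.ι ''ᵁ O' = O := ⟨V.ι ⁻¹ᵁ O, by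
    rw [Scheme.Hom.image_preimage_eq_opensRange_inf, Scheme.Opens.opensRange_ι,
      inf_eq_right.mpr hO]⟩
  rw [V.ι.preimage_image_eq] at h1
  have := key _ (image_morphismRestrict_preimage μ V O) _ h1
  exact ConcreteCategory.bijective_of_isIso (μ.app (V.ι ''ᵁ O))

theorem eq_zero_of_basicOpen_inf_dense {S : Scheme.{0}} [IsReduced S] {T O : S.Opens}
    (hO : Dense (O : Set S)) (z : Γ(S, T))
    (hz : S.presheaf.map (homOfLE (inf_le_left : T ⊓ O ≤ T)).op z = 0) : z = 0 := by
  rw [← basicOpen_eq_bot_iff]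
  have h1 : S.basicOpen z ⊓ O = ⊥ := by
    have h2 := S.basicOpen_res z (homOfLE (inf_le_left : T ⊓ O ≤ T)).op
    rw [hz, Scheme.basicOpen_zero] at h2
    rw [eq_bot_iff, h2]
    exact fun x hx => ⟨⟨S.basicOpen_le z hx.1, hx.2⟩, hx.1⟩
  by_contra hne
  obtain ⟨x, hx⟩ := (TopologicalSpace.Opens.ne_bot_iff_nonempty _).mp hne
  obtain ⟨y, hy, hyO⟩ := hO.inter_open_nonempty _ (S.basicOpen z).2 ⟨x, hx⟩
  have : y ∈ S.basicOpen z ⊓ O := ⟨hy, hyO⟩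
  rw [h1] at this
  exact this

/-- A nonzerodivisor on an affine open stays one in every stalk, hence on every smaller open, affine
or not. -/
theorem eq_zero_of_res_mul_eq_zero {S : Scheme.{0}} {W O : S.Opens} (hW : IsAffineOpen W)
    (h : O ≤ W) {a : Γ(S, W)} (ha : a ∈ nonZeroDivisors Γ(S, W)) {z : Γ(S, O)}
    (hz : S.presheaf.map (homOfLE h).op a * z = 0) : z = 0 := by
  refine TopCat.Presheaf.section_ext S.sheaf O z 0 fun x hx => ?_
  change S.presheaf.germ O x hx z = S.presheaf.germ O x hx 0
  rw [map_zero]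
  have h1 := congrArg (S.presheaf.germ O x hx) hz
  rw [map_mul, map_zero, S.presheaf.germ_res_apply] at h1
  obtain ⟨x, rfl⟩ : ∃ y : W, (y : S) = x := ⟨⟨x, h hx⟩, rfl⟩
  have := hW.isLocalization_stalk x
  have h2 := IsLocalization.map_nonZeroDivisors_le (hW.primeIdealOf x).asIdeal.primeCompl
    (S.presheaf.stalk (x : S)) (Submonoid.mem_map_of_mem _ ha)
  exact (mul_left_mem_nonZeroDivisors_eq_zero_iff h2).mp h1

section Birational

variable {S S' : Scheme.{0}} (μ : S ⟶ S') (V : S'.Opens) [IsIso (μ ∣_ V)] {W : S'.Opens}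
  (hW : IsAffineOpen W)

include hW

/-- Over `W ⊓ V` the function `z` comes from `S'`, where `c` can be cancelled. So `z` vanishes on a
dense open subset of a reduced scheme. -/
theorem eq_zero_of_app_mul_eq_zero [IsReduced S] (hV : Dense ((μ ⁻¹ᵁ V : S.Opens) : Set S))
    {c : Γ(S', W)} (hc : c ∈ nonZeroDivisors Γ(S', W)) {z : Γ(S, μ ⁻¹ᵁ W)}
    (hz : μ.app W c * z = 0) : z = 0 := by
  have hbij := bijective_app_of_isIso_morphismRestrict μ V (W ⊓ V) inf_le_right
  refine eq_zero_of_basicOpen_inf_dense (O := μ ⁻¹ᵁ V) hV z ?_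
  let ρ := S.presheaf.map (homOfLE (μ.preimage_mono inf_le_left : μ ⁻¹ᵁ (W ⊓ V) ≤ μ ⁻¹ᵁ W)).op
  change ρ z = 0
  obtain ⟨w, hw⟩ := hbij.2 (ρ z)
  have hw0 : w = 0 := by
    refine eq_zero_of_res_mul_eq_zero hW inf_le_left hc (hbij.1 ?_)
    have h1 := congrArg ρ hz
    rw [map_mul, map_zero] at h1
    rw [map_mul, map_zero, hw]
    refine Eq.trans ?_ h1
    congr 1
    exact congr($(μ.naturality (homOfLE (inf_le_left : W ⊓ V ≤ W)).op) c)
  rw [← hw, hw0, map_zero]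

/-- Since `μ` is an isomorphism over the basic open set of `a`, which is a localization, kernel and
cokernel of `μ.app W` are killed by powers of `a`. This is the statement for the kernel; the next
one is for the cokernel. -/
theorem exists_pow_mul_eq_zero_of_app_eq_zero {a : Γ(S', W)} (ha : S'.basicOpen a ≤ V)
    {x : Γ(S', W)} (hx : μ.app W x = 0) : ∃ n : ℕ, a ^ n * x = 0 := by
  have hbij := bijective_app_of_isIso_morphismRestrict μ V _ ha
  have h0 : S'.presheaf.map (homOfLE (S'.basicOpen_le a)).op x = 0 := by
    refine hbij.1 ?_
    have h1 := congr($(μ.naturality (homOfLE (S'.basicOpen_le a)).op) x)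
    rw [map_zero]
    refine h1.trans ?_
    rw [CommRingCat.comp_apply, hx, map_zero]
  have := hW.isLocalization_basicOpen a
  obtain ⟨⟨_, n, rfl⟩, hn⟩ := (IsLocalization.map_eq_zero_iff (Submonoid.powers a)
    Γ(S', S'.basicOpen a) x).mp h0
  exact ⟨n, hn⟩

theorem exists_app_eq_pow_mul [IsAffineHom μ] {a : Γ(S', W)} (ha : S'.basicOpen a ≤ V)
    (z : Γ(S, μ ⁻¹ᵁ W)) : ∃ (n : ℕ) (x : Γ(S', W)), μ.app W x = μ.app W a ^ n * z := by
  have hbij := bijective_app_of_isIso_morphismRestrict μ V _ ha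
  have hT : IsAffineOpen (μ ⁻¹ᵁ W) := hW.preimage μ
  have := hW.isLocalization_basicOpen a
  let ρ := S'.presheaf.map (homOfLE (S'.basicOpen_le a)).op
  let ρ' := S.presheaf.map (homOfLE (μ.preimage_mono (S'.basicOpen_le a))).op
  let := ρ'.hom.toAlgebra
  have hloc : IsLocalization.Away (μ.app W a) Γ(S, μ ⁻¹ᵁ S'.basicOpen a) :=
    hT.isLocalization_of_eq_basicOpen _ _ (Scheme.preimage_basicOpen μ a)
  have hnat : ∀ x, μ.app (S'.basicOpen a) (ρ x) = ρ' (μ.app W x) := fun x =>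
    congr($(μ.naturality (homOfLE (S'.basicOpen_le a)).op) x)
  obtain ⟨w, hw⟩ := hbij.2 (ρ' z)
  obtain ⟨⟨x, ⟨_, n, rfl⟩⟩, hx⟩ := IsLocalization.surj (Submonoid.powers a) w
  have h1 : ρ' (μ.app W x) = ρ' (μ.app W a ^ n * z) := by
    rw [← hnat, map_mul, ← hw, ← map_pow, ← hnat, mul_comm, ← map_mul]
    exact congrArg _ hx.symm
  obtain ⟨⟨_, k, rfl⟩, hk⟩ := (IsLocalization.eq_iff_exists (Submonoid.powers (μ.app W a))
    Γ(S, μ ⁻¹ᵁ S'.basicOpen a)).mp h1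
  refine ⟨k + n, a ^ k * x, ?_⟩
  rw [map_mul, map_pow, pow_add, mul_assoc]
  exact hk

end Birational

/-! ### The normalization as a local model of the spectral curve -/

section

variable {X : Scheme.{0}} {s : X ⟶ Spec (CommRingCat.of ℂ)} {S' S : Scheme.{0}} {π' : S' ⟶ X}

/-- The pullback of `lam` to the normalization. -/
def liftCoeff (lam : PullbackSection s π') (μ : S ⟶ S') (q : S ⟶ X) (hq : q = μ ≫ π')
    (U : X.affineOpens) (ω : Frame s U.1) : Γ(S, q ⁻¹ᵁ U.1) :=
  μ.appLE (π' ⁻¹ᵁ U.1) (q ⁻¹ᵁ U.1) (by rw [hq]; rfl) (lam.coeff U ω)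

theorem app_comp_appLE_of_eq {π' : S' ⟶ X} {μ : S ⟶ S'} {q : S ⟶ X} (hq : q = μ ≫ π') (U : X.Opens)
    (e : q ⁻¹ᵁ U ≤ μ ⁻¹ᵁ π' ⁻¹ᵁ U) :
    π'.app U ≫ μ.appLE (π' ⁻¹ᵁ U) (q ⁻¹ᵁ U) e = q.app U := by
  subst hq
  rw [Scheme.Hom.app_eq_appLE (f := μ ≫ π')]
  exact (Scheme.Hom.comp_appLE _ _ _ _ _).symm

theorem liftCoeff_res (lam : PullbackSection s π') (μ : S ⟶ S') (q : S ⟶ X) (hq : q = μ ≫ π')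
    (U V : X.affineOpens) (h : V.1 ≤ U.1) (ω : Frame s U.1) (ω' : Frame s V.1)
    (u : Γ(X, V.1)) (hu : resDifferential s h ω.form = u • ω'.form) :
    liftCoeff lam μ q hq V ω' =
      q.app V.1 u * S.presheaf.map (homOfLE (q.preimage_mono h)).op (liftCoeff lam μ q hq U ω) := by
  simp only [liftCoeff, lam.coeff_res U V h ω ω' u hu, map_mul]
  congr 1
  · exact congr($(app_comp_appLE_of_eq hq V.1 _) u)
  · rw [← CommRingCat.comp_apply, ← CommRingCat.comp_apply, Scheme.Hom.map_appLE,
      Scheme.Hom.appLE_map]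

theorem IsSpectralCurve.coordinateRing {m : ℕ} {b : ∀ i : ℕ, CanonicalSection s (2 * i)}
    {pm : CanonicalSection s m} {lam : PullbackSection s π'} (h : IsSpectralCurve m b pm π' lam)
    (hm : 1 ≤ m) (U : X.affineOpens) [Nontrivial Γ(X, U.1)] (ω : Frame s U.1) :
    letI := (π'.app U.1).hom.toAlgebra
    (∀ x : Γ(S', π' ⁻¹ᵁ U.1), ∃ r : Γ(X, U.1)[X], aeval (lam.coeff U ω) r = x) ∧
      (∀ r : Γ(X, U.1)[X], aeval (lam.coeff U ω) r = 0 ↔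
        expand _ 2 (quotientPolynomial m b pm U ω) ∣ r) ∧
      Algebra.IsIntegral Γ(X, U.1) Γ(S', π' ⁻¹ᵁ U.1) := by
  let := (π'.app U.1).hom.toAlgebra
  have h1 : ∀ r, aeval (lam.coeff U ω) r = 0 ↔
        expand _ 2 (quotientPolynomial m b pm U ω) ∣ r := fun r => by
    rw [expand_quotientPolynomial, ← Ideal.mem_span_singleton, ← h.ker_eq U ω]
    rfl
  refine ⟨h.surjective U ω, h1, ⟨fun x => ?_⟩⟩
  obtain ⟨r, rfl⟩ : ∃ r, aeval (lam.coeff U ω) r = x := h.surjective U ω x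
  have hint : IsIntegral Γ(X, U.1) (lam.coeff U ω) :=
    ⟨_, (quotientPolynomial_natDegree_monic m b pm U ω hm).2.expand two_pos, (h1 _).mpr dvd_rfl⟩
  exact (adjoin_le_integralClosure hint) (aeval_mem_adjoin_singleton _ _)

/-- Taking the remainder modulo the monic `f` is `A`-linear, so torsion in `A[t]/(f)` would be
torsion in `A[t]`. -/
theorem smul_eq_zero_of_monic_quotient {A B : Type*} [CommRing A] [IsDomain A] [CommRing B]
    [Algebra A B] (t : B) (f : A[X]) (hf : f.Monic) (hs : ∀ x : B, ∃ r : A[X], aeval t r = x)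
    (hk : ∀ r : A[X], aeval t r = 0 ↔ f ∣ r) {c : A} (hc : c ≠ 0) {x : B} (hx : c • x = 0) :
    x = 0 := by
  obtain ⟨r, rfl⟩ := hs x
  rw [← map_smul, hk, ← modByMonic_eq_zero_iff_dvd hf, smul_modByMonic] at hx
  rw [hk, ← modByMonic_eq_zero_iff_dvd hf]
  exact (smul_eq_zero.mp hx).resolve_left hc

theorem IsNormalization.isReduced {μ : S ⟶ S'} (hμ : IsNormalization μ) : IsReduced S :=
  have := hμ.isDomain_stalk
  isReduced_of_isReduced_stalk S

/-- A nonempty basic open subset of `U` over which the integral morphism `π'` factors through a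
given dense open subset. -/
theorem exists_basicOpen_le_of_dense {U : X.Opens} (hU : IsAffineOpen (π' ⁻¹ᵁ U))
    [IsDomain Γ(X, U)] [IsNoetherianRing Γ(S', π' ⁻¹ᵁ U)] (hint : (π'.app U).hom.IsIntegral)
    (V : S'.Opens) (hV : Dense (V : Set S')) :
    ∃ a : Γ(X, U), a ≠ 0 ∧ S'.basicOpen (π'.app U a) ≤ V := by
  let := (π'.app U).hom.toAlgebra
  have : Algebra.IsIntegral Γ(X, U) Γ(S', π' ⁻¹ᵁ U) := ⟨hint⟩
  obtain ⟨a, ha, h⟩ := exists_basicOpen_subset_of_dense (A := Γ(X, U))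
    (((hU.fromSpec ⁻¹ᵁ V : (Spec Γ(S', π' ⁻¹ᵁ U)).Opens)) : Set (Spec Γ(S', π' ⁻¹ᵁ U)))
    (hU.fromSpec ⁻¹ᵁ V).2 (hV.preimage hU.fromSpec.isOpenEmbedding.isOpenMap)
  refine ⟨a, ha, ?_⟩
  rw [← hU.fromSpec_image_basicOpen]
  rintro _ ⟨y, hy, rfl⟩
  exact h hy

/-- The coordinate ring of `S'` is exactly `A[t]/(g(t ^ 2))`, torsion-free over `A`. Normalizing
changes it only by torsion, because `μ` is an isomorphism over a dense open set which, by
integrality, contains the preimage of some `D(a)` with `a ≠ 0` in `A`. -/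
theorem spectralModel [IsIntegral X] [Smooth s] [IsReduced S'] {m : ℕ}
    {b : ∀ i : ℕ, CanonicalSection s (2 * i)}
    {pm : CanonicalSection s m} {lam : PullbackSection s π'} (h : IsSpectralCurve m b pm π' lam)
    (hm : 1 ≤ m) {μ : S ⟶ S'} (hμ : IsNormalization μ) (q : S ⟶ X) (hq : q = μ ≫ π')
    (U : X.affineOpens) [Nonempty U.1] (ω : Frame s U.1) :
    letI := (q.app U.1).hom.toAlgebra
    SpectralModel (quotientPolynomial m b pm U ω) (liftCoeff lam μ q hq U ω) ∧
      Algebra.IsIntegral Γ(X, U.1) Γ(S, q ⁻¹ᵁ U.1) := by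
  subst hq
  have := hμ.isReduced
  have := hμ.isIntegralHom
  have := h.isAffineHom
  obtain ⟨hs, hk, hint⟩ := h.coordinateRing hm U ω
  obtain ⟨hA, -⟩ := ω.coordinateRing s U
  let := (π'.app U.1).hom.toAlgebra
  let := ((μ ≫ π').app U.1).hom.toAlgebra
  let φ : Γ(S', π' ⁻¹ᵁ U.1) →ₐ[Γ(X, U.1)] Γ(S, (μ ≫ π') ⁻¹ᵁ U.1) :=
    { (μ.app (π' ⁻¹ᵁ U.1)).hom with
      commutes' := fun a => congr($(Scheme.Hom.comp_app μ π' U.1) a).symm }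
  have hlam : liftCoeff lam μ (μ ≫ π') rfl U ω = φ (lam.coeff U ω) := by
    have h1 : μ.appLE (π' ⁻¹ᵁ U.1) (μ ⁻¹ᵁ π' ⁻¹ᵁ U.1) le_rfl = μ.app (π' ⁻¹ᵁ U.1) :=
      μ.appLE_eq_app
    exact congr($h1 (lam.coeff U ω))
  have hmonic := quotientPolynomial_natDegree_monic m b pm U ω hm
  have htf : ∀ c : Γ(X, U.1), c ≠ 0 → ∀ x : Γ(S', π' ⁻¹ᵁ U.1), c • x = 0 → x = 0 :=
    fun c hc x => smul_eq_zero_of_monic_quotient _ _ (hmonic.2.expand two_pos) hs hk hc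
  have hW : IsAffineOpen (π' ⁻¹ᵁ U.1) := U.2.preimage π'
  have : IsNoetherianRing Γ(S', π' ⁻¹ᵁ U.1) :=
    isNoetherianRing_of_surjective _ _ (aeval (lam.coeff U ω)).toRingHom hs
  obtain ⟨V, hVd, hVd', hV⟩ := hμ.birational
  have htfB : ∀ c : Γ(X, U.1), c ≠ 0 → ∀ z : Γ(S, (μ ≫ π') ⁻¹ᵁ U.1), c • z = 0 → z = 0 := by
    intro c hc z hz
    refine eq_zero_of_app_mul_eq_zero μ V hW hVd' (c := π'.app U.1 c) ?_ ?_
    · exact mem_nonZeroDivisors_iff_right.mpr fun x hx => htf c hc x (by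
        rw [mul_comm] at hx; exact hx)
    · rw [Algebra.smul_def, ← φ.commutes] at hz
      exact hz
  obtain ⟨a, ha, haV⟩ := exists_basicOpen_le_of_dense hW
    (Algebra.isIntegral_def.mp hint) V hVd
  refine ⟨⟨hmonic.2, ?_, ?_, ?_, ?_⟩, ?_⟩
  · rw [hlam, ← map_pow, aeval_algHom_apply, ← expand_aeval, (hk _).mpr dvd_rfl, map_zero]
  · intro r hr
    rw [hlam, aeval_algHom_apply] at hr
    rw [← hk]
    obtain ⟨n, hn⟩ := exists_pow_mul_eq_zero_of_app_eq_zero μ V hW haV hr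
    refine htf _ (pow_ne_zero n ha) _ ?_
    rw [Algebra.smul_def, map_pow]
    exact hn
  · intro z
    obtain ⟨n, x, hx⟩ := exists_app_eq_pow_mul μ V hW haV z
    obtain ⟨r, rfl⟩ := hs x
    refine ⟨a ^ n, pow_ne_zero n ha, r, ?_⟩
    rw [hlam, aeval_algHom_apply, Algebra.smul_def, ← φ.commutes, map_pow, map_pow]
    exact hx.symm
  · exact ⟨fun c hc x y hxy => sub_eq_zero.mp (htfB c hc.ne_zero _ (by
      rw [smul_sub, sub_eq_zero]; exact hxy))⟩
  · refine Algebra.isIntegral_def.mpr fun z => ?_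
    have h1 := RingHom.IsIntegral.trans _ _ (Algebra.isIntegral_def.mp hint)
      (hμ.isIntegralHom.isIntegral_app _ hW)
    have h2 : (algebraMap Γ(X, U.1) Γ(S, (μ ≫ π') ⁻¹ᵁ U.1)) =
      (μ.app (π' ⁻¹ᵁ U.1)).hom.comp (algebraMap Γ(X, U.1) Γ(S', π' ⁻¹ᵁ U.1)) :=
        RingHom.ext fun a => (φ.commutes a).symm
    have h3 := h1 z
    rw [← h2] at h3
    exact h3

end

/-- An endomorphism of a scheme over `X` is the identity if it is the identity on functions over
the members of an affine open cover. -/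
theorem eq_id_of_appLE_eq_id {S : Scheme.{0}} (τ : S ⟶ S)
    (h : ∀ x : S, ∃ T : S.Opens, x ∈ T ∧ IsAffineOpen T ∧ ∃ e : T ≤ τ ⁻¹ᵁ T, τ.appLE T T e = 𝟙 _) :
    τ = 𝟙 S := by
  refine Scheme.hom_ext_of_forall _ _ fun x => ?_
  obtain ⟨T, hx, hT, e, he⟩ := h x
  refine ⟨T, hx, ?_⟩
  have h1 := hT.SpecMap_appLE_fromSpec τ hT e
  rw [he, Spec.map_id, Category.id_comp] at h1
  rw [Category.comp_id, ← hT.isoSpec_hom_fromSpec, Category.assoc, ← h1]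

/-! ### Quotients by an involution -/

section Quotient

variable {S Sbar : Scheme.{0}} {σ : S ⟶ S} {p : S ⟶ Sbar}

theorem preimage_le_of_comp_eq (h : σ ≫ p = p) (V : Sbar.Opens) : p ⁻¹ᵁ V ≤ σ ⁻¹ᵁ (p ⁻¹ᵁ V) := by
  conv_lhs => rw [← h]
  exact le_rfl

/-- The action `f ↦ f ∘ σ` on functions on `p⁻¹ V`. -/
def sectionAction (h : σ ≫ p = p) (V : Sbar.Opens) : Γ(S, p ⁻¹ᵁ V) →+* Γ(S, p ⁻¹ᵁ V) :=
  (σ.appLE (p ⁻¹ᵁ V) (p ⁻¹ᵁ V) (preimage_le_of_comp_eq h V)).hom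

theorem sectionAction_app (h : σ ≫ p = p) (V : Sbar.Opens) (f : Γ(Sbar, V)) :
    sectionAction h V (p.app V f) = p.app V f := by
  have h1 : ∀ (q : S ⟶ Sbar) (hq : q = p) (e : p ⁻¹ᵁ V ≤ q ⁻¹ᵁ V),
      q.appLE V (p ⁻¹ᵁ V) e = p.app V := by
    rintro _ rfl e
    rw [Scheme.Hom.appLE_eq_app]
  have h2 := h1 _ h (by rw [h])
  rw [Scheme.Hom.comp_appLE] at h2
  exact congr($h2 f)

theorem sectionAction_res (h : σ ≫ p = p) {U V : Sbar.Opens} (i : V ≤ U) (f : Γ(S, p ⁻¹ᵁ U)) :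
    sectionAction h V (S.presheaf.map (homOfLE (p.preimage_mono i)).op f) =
      S.presheaf.map (homOfLE (p.preimage_mono i)).op (sectionAction h U f) := by
  simp only [sectionAction]
  rw [← CommRingCat.comp_apply, ← CommRingCat.comp_apply, Scheme.Hom.map_appLE,
    Scheme.Hom.appLE_map]

theorem sectionAction_involutive (h : σ ≫ p = p) (hσ : σ ≫ σ = 𝟙 S) (V : Sbar.Opens)
    (f : Γ(S, p ⁻¹ᵁ V)) : sectionAction h V (sectionAction h V f) = f := by
  simp only [sectionAction]
  have h1 : ∀ (q : S ⟶ S) (hq : q = 𝟙 S) (e : p ⁻¹ᵁ V ≤ q ⁻¹ᵁ (p ⁻¹ᵁ V)),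
      q.appLE (p ⁻¹ᵁ V) (p ⁻¹ᵁ V) e = 𝟙 _ := by
    rintro _ rfl e
    exact (Category.id_comp _).trans (S.presheaf.map_id _)
  have h2 := h1 (σ ≫ σ) hσ (by rw [hσ]; exact le_rfl)
  rw [← Scheme.Hom.appLE_comp_appLE σ σ _ (p ⁻¹ᵁ V) _ (preimage_le_of_comp_eq h V)
    (preimage_le_of_comp_eq h V)] at h2
  exact congr($h2 f)

namespace IsQuotient

variable (hp : IsQuotient σ p)
include hp

theorem mem_range_of_sectionAction (V : Sbar.Opens) {f : Γ(S, p ⁻¹ᵁ V)}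
    (hf : sectionAction hp.comp_eq V f = f) : ∃ g, p.app V g = f :=
  (hp.mem_range_iff V (preimage_le_of_comp_eq hp.comp_eq V) f).mpr hf

variable (hσ : σ ≫ σ = 𝟙 S)
include hσ

/-- A function `f` is a root of `X ^ 2 - (f + σ f) X + f σ f`, whose coefficients are invariant. -/
theorem isIntegral_app (V : Sbar.Opens) : (p.app V).hom.IsIntegral := by
  intro f
  obtain ⟨t, ht⟩ := hp.mem_range_of_sectionAction V (f := f + sectionAction hp.comp_eq V f) (by
    rw [map_add, sectionAction_involutive hp.comp_eq hσ, add_comm])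
  obtain ⟨n, hn⟩ := hp.mem_range_of_sectionAction V (f := f * sectionAction hp.comp_eq V f) (by
    rw [map_mul, sectionAction_involutive hp.comp_eq hσ, mul_comm])
  refine ⟨Polynomial.X ^ 2 - C t * Polynomial.X + C n, by monicity!, ?_⟩
  have ht' : (p.app V).hom t = f + sectionAction hp.comp_eq V f := ht
  have hn' : (p.app V).hom n = f * sectionAction hp.comp_eq V f := hn
  simp only [eval₂_add, eval₂_sub, eval₂_mul, eval₂_pow, eval₂_X, eval₂_C, ht', hn']
  ring

/-- The image is closed by integrality. On its complement the structure sheaf injects into functions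
on the empty set, so the complement is empty. -/
theorem surjective : Function.Surjective p := by
  have := hp.isAffineHom
  have : IsIntegralHom p := ⟨fun V _ => hp.isIntegral_app hσ V⟩
  have hcl : IsClosed (Set.range p) := p.isClosedMap.isClosed_range
  intro y
  by_contra hy
  let O : Sbar.Opens := ⟨(Set.range p)ᶜ, hcl.isOpen_compl⟩
  have hO : p ⁻¹ᵁ O = ⊥ := eq_bot_iff.mpr fun x hx => hx ⟨x, rfl⟩
  have hsub : Subsingleton Γ(S, p ⁻¹ᵁ O) := by
    rw [hO]
    infer_instance
  have h1 : (1 : Γ(Sbar, O)) = 0 := hp.injective O (Subsingleton.elim _ _)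
  have h2 := congrArg (Sbar.presheaf.germ O y hy) h1
  rw [map_one, map_zero] at h2
  exact one_ne_zero h2

/-- Invariant functions suffice to separate: a function `g` with small basic open set around `x` is
replaced by a symmetric function of `g` and `σ g`. -/
theorem exists_basicOpen_le {V W : Sbar.Opens} (hV : IsAffineOpen (p ⁻¹ᵁ V)) (hWV : W ≤ V) (x : S)
    (hx : x ∈ p ⁻¹ᵁ W) :
    ∃ f : Γ(Sbar, V), p x ∈ Sbar.basicOpen f ∧ Sbar.basicOpen f ≤ W := by
  obtain ⟨g, hgW, hxg⟩ := hV.exists_basicOpen_le ⟨x, hx⟩ (p.preimage_mono hWV hx)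
  let g' := sectionAction hp.comp_eq V g
  have hg' : S.basicOpen g' ≤ p ⁻¹ᵁ W := by
    have h1 : S.basicOpen g' = p ⁻¹ᵁ V ⊓ σ ⁻¹ᵁ S.basicOpen g :=
      Scheme.basicOpen_appLE _ _ _ _ _
    rw [h1]
    refine inf_le_right.trans ((σ.preimage_mono hgW).trans ?_)
    change (σ ≫ p) ⁻¹ᵁ W ≤ p ⁻¹ᵁ W
    rw [hp.comp_eq]
  suffices ∃ f, sectionAction hp.comp_eq V f = f ∧ x ∈ S.basicOpen f ∧
      S.basicOpen f ≤ p ⁻¹ᵁ W by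
    obtain ⟨f, hf, hxf, hfW⟩ := this
    obtain ⟨f, rfl⟩ := hp.mem_range_of_sectionAction V hf
    rw [← Scheme.preimage_basicOpen] at hxf hfW
    refine ⟨f, hxf, fun y hy => ?_⟩
    obtain ⟨y, rfl⟩ := hp.surjective hσ y
    exact hfW hy
  have hinv := sectionAction_involutive hp.comp_eq hσ V g
  -- If `σ g` is invertible at `x`, the product `g * σ g` works. Otherwise the sum does, being a
  -- unit plus a nonunit in a local ring.
  by_cases hxg' : x ∈ S.basicOpen g'
  · refine ⟨g * g', by rw [map_mul, hinv, mul_comm], ?_, ?_⟩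
    · rw [Scheme.basicOpen_mul]
      exact ⟨hxg, hxg'⟩
    · rw [Scheme.basicOpen_mul]
      exact inf_le_left.trans hgW
  · have hxV : x ∈ p ⁻¹ᵁ V := p.preimage_mono hWV hx
    refine ⟨g + g', by rw [map_add, hinv, add_comm], ?_, ?_⟩
    · rw [Scheme.mem_basicOpen _ _ _ hxV] at hxg hxg' ⊢
      by_contra hn
      rw [map_add] at hn
      refine IsLocalRing.nonunits_add (mem_nonunits_iff.mpr hn)
        (mem_nonunits_iff.mpr (mt (IsUnit.neg_iff _).mp hxg')) ?_
      rwa [add_neg_cancel_right]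
    · refine (Scheme.basicOpen_add_le _ _ _).trans (sup_le hgW hg')

/-- The functions on `V` with affine basic open set generate the unit ideal after the integral
extension to `p⁻¹ V`, by the previous lemma, and therefore already on `V`. -/
theorem isAffineOpen {V : Sbar.Opens} (hV : IsAffineOpen (p ⁻¹ᵁ V)) : IsAffineOpen V := by
  refine isAffineOpen_of_isAffineOpen_basicOpen V {f | IsAffineOpen (Sbar.basicOpen f)} ?_
    fun _ h => h
  rw [← Ideal.map_eq_top_iff (p.app V).hom (hp.injective V) (hp.isIntegral_app hσ V),
    Ideal.map_span, ← hV.iSup_basicOpen_eq_self_iff]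
  refine le_antisymm (iSup_le fun f => S.basicOpen_le _) fun x hx => ?_
  obtain ⟨_, ⟨W, hW, rfl⟩, hxW, hWV⟩ := Sbar.isBasis_affineOpens.exists_subset_of_mem_open
    (show p x ∈ (V : Set Sbar) from hx) V.2
  obtain ⟨f, hxf, hfW⟩ := hp.exists_basicOpen_le hσ hV hWV x hxW
  rw [TopologicalSpace.Opens.mem_iSup]
  have hf : IsAffineOpen (Sbar.basicOpen f) := by
    have h1 := Sbar.basicOpen_res f (homOfLE (show W ≤ V from hWV)).op
    rw [inf_eq_right.mpr hfW] at h1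
    rw [← h1]
    exact IsAffineOpen.basicOpen hW _
  refine ⟨⟨_, f, hf, rfl⟩, ?_⟩
  have h2 : x ∈ p ⁻¹ᵁ Sbar.basicOpen f := hxf
  rw [Scheme.preimage_basicOpen] at h2
  exact h2

end IsQuotient

end Quotient

/-! ### Sections of the eigensheaf -/

section AntiInvariants

variable {S Sbar : Scheme.{0}} {σ : S ⟶ S} {p : S ⟶ Sbar} (h : σ ≫ p = p)

/-- The inclusion of `Γ(ℒ, U)` into `Γ(S, p⁻¹ U)`. -/
def antiInvariantsIncl (U : Sbar.Opens) (l : Γ(antiInvariants σ p h, U)) : Γ(S, p ⁻¹ᵁ U) :=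
  (kernel.ι (𝟙 _ + pushforwardAction σ p h) : antiInvariants σ p h ⟶ _).app U l

theorem antiInvariantsIncl_smul (U : Sbar.Opens) (a : Γ(Sbar, U))
    (l : Γ(antiInvariants σ p h, U)) :
    antiInvariantsIncl h U (a • l) = p.app U a * antiInvariantsIncl h U l := by
  exact Scheme.Modules.Hom.app_smul _ a l

theorem antiInvariantsIncl_res {U V : Sbar.Opens} (i : V ≤ U) (l : Γ(antiInvariants σ p h, U)) :
    antiInvariantsIncl h V ((antiInvariants σ p h).presheaf.map (homOfLE i).op l) =
      S.presheaf.map (homOfLE (p.preimage_mono i)).op (antiInvariantsIncl h U l) :=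
  congr($((show antiInvariants σ p h ⟶ _ from
    kernel.ι (𝟙 _ + pushforwardAction σ p h)).mapPresheaf.naturality (homOfLE i).op) l)

/-- Taking sections over `U` preserves kernels, so the sections of the categorical kernel are the
anti-invariant functions. -/
theorem antiInvariantsIncl_isKernel (U : Sbar.Opens) :
    Function.Injective (antiInvariantsIncl h U) ∧
      ∀ f, sectionAction h U f = -f ↔ f ∈ Set.range (antiInvariantsIncl h U) := by
  let F : Sbar.Modules ⥤ Ab := Scheme.Modules.toPresheaf Sbar ⋙ (evaluation _ _).obj (.op U)
  have : PreservesLimitsOfShape WalkingParallelPair F := by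
    have : PreservesLimitsOfShape WalkingParallelPair
        ((evaluation (TopologicalSpace.Opens Sbar)ᵒᵖ Ab.{0}).obj (.op U)) := inferInstance
    exact comp_preservesLimitsOfShape _ _
  have : F.PreservesZeroMorphisms := ⟨fun _ _ => rfl⟩
  let φ := 𝟙 _ + pushforwardAction σ p h
  have hl := isLimitForkMapOfIsLimit' F (kernel.condition φ) (kernelIsKernel φ)
  have hφ : ∀ f : Γ(S, p ⁻¹ᵁ U), φ.app U f = f + sectionAction h U f := fun f => rfl
  refine ⟨?_, fun f => ⟨fun hf => ?_, ?_⟩⟩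
  · have hm : Mono (F.map (kernel.ι φ)) := mono_of_isLimit_fork hl
    exact (AddCommGrpCat.mono_iff_injective _).mp hm
  · let K := AddMonoidHom.ker (F.map φ).hom
    obtain ⟨l, hl'⟩ := KernelFork.IsLimit.lift' hl (AddCommGrpCat.ofHom K.subtype) (by
      ext x; exact x.2)
    refine ⟨l ⟨f, ?_⟩, congr($hl' ⟨f, _⟩)⟩
    exact (hφ f).trans (by rw [hf]; exact add_neg_cancel f)
  · rintro ⟨l, rfl⟩
    rw [eq_neg_iff_add_eq_zero, add_comm]
    refine (hφ _).symm.trans ?_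
    exact congr($(congrArg F.map (kernel.condition φ)) l)

end AntiInvariants

theorem localization_isIntegrallyClosed_of_stalk {S : Scheme.{0}}
    (h₁ : ∀ x : S, IsDomain (S.presheaf.stalk x))
    (h₂ : ∀ x : S, IsIntegrallyClosed (S.presheaf.stalk x)) {T : S.Opens} (hT : IsAffineOpen T)
    (q : Ideal Γ(S, T)) [hq : q.IsPrime] :
    IsDomain (Localization.AtPrime q) ∧ IsIntegrallyClosed (Localization.AtPrime q) := by
  let y : PrimeSpectrum Γ(S, T) := ⟨q, hq⟩
  have hy : hT.fromSpec y ∈ T := by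
    have : hT.fromSpec y ∈ hT.fromSpec.opensRange := ⟨y, rfl⟩
    rwa [hT.opensRange_fromSpec] at this
  let := TopCat.Presheaf.algebra_section_stalk S.presheaf (⟨hT.fromSpec y, hy⟩ : T)
  have : IsLocalization.AtPrime (S.presheaf.stalk (hT.fromSpec y)) q :=
    hT.isLocalization_stalk' y hy
  let e := IsLocalization.algEquiv q.primeCompl (S.presheaf.stalk (hT.fromSpec y))
    (Localization.AtPrime q)
  have := h₁ (hT.fromSpec y)
  have := h₂ (hT.fromSpec y)
  exact ⟨e.symm.toMulEquiv.isDomain _, IsIntegrallyClosed.of_equiv e.toRingEquiv⟩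

/-! ### The quotient of the normalization as a spectral cover -/

variable {X : Scheme.{0}} {s : X ⟶ Spec (CommRingCat.of ℂ)} {S Sbar : Scheme.{0}}

/-- `p : S ⟶ Sbar` is the quotient by an involution over the curve `X`, `lam` is an anti-invariant
section of the pullback of `K_X` to `S` whose local models are those of a spectral curve with last
coefficient `pm ^ 2`, and locally over `X` there is an anti-invariant function which does not
vanish at the zeros of `lam`. -/
structure IsSpectralCover {m : ℕ} (pm : CanonicalSection s m) (σ : S ⟶ S) (p : S ⟶ Sbar)
    (πbar : Sbar ⟶ X)
    (lam : ∀ U : X.affineOpens, Frame s U.1 → Γ(S, p ⁻¹ᵁ πbar ⁻¹ᵁ U.1)) : Prop where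
  quotient : IsQuotient σ p
  sq : σ ≫ σ = 𝟙 S
  isAffineHom : IsAffineHom πbar
  coeff_ne_zero : ∀ (U : X.affineOpens) [Nonempty U.1] (ω : Frame s U.1), pm.coeff U ω ≠ 0
  lam_res : ∀ (U V : X.affineOpens) (h : V.1 ≤ U.1) (ω : Frame s U.1) (ω' : Frame s V.1)
    (u : Γ(X, V.1)), resDifferential s h ω.form = u • ω'.form →
      lam V ω' = p.app _ (πbar.app V.1 u) *
        S.presheaf.map (homOfLE (p.preimage_mono (πbar.preimage_mono h))).op (lam U ω)
  lam_anti : ∀ (U : X.affineOpens) (ω : Frame s U.1),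
    sectionAction quotient.comp_eq _ (lam U ω) = -lam U ω
  model : ∀ (U : X.affineOpens) [Nonempty U.1] (ω : Frame s U.1),
    letI := ((p ≫ πbar).app U.1).hom.toAlgebra
    ∃ g : Γ(X, U.1)[X], g.natDegree = m ∧ g.coeff 0 = pm.coeff U ω ^ 2 ∧
      SpectralModel (B := Γ(S, (p ≫ πbar) ⁻¹ᵁ U.1)) g (lam U ω)
  cofactor : ∀ (U : X.affineOpens) [Nonempty U.1] (ω : Frame s U.1),
    ∃ y, sectionAction quotient.comp_eq _ y = -y ∧ ∃ c d : Γ(Sbar, πbar ⁻¹ᵁ U.1),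
      p.app _ c * lam U ω ^ 2 + p.app _ d * y ^ 2 = 1
  finite : ∀ (U : X.affineOpens) [Nonempty U.1], Nonempty (Frame s U.1) →
    (πbar.app U.1).hom.Finite

/-- The action of an involution on functions, as a homomorphism of algebras over the base. -/
def sectionActionAlgHom {σ : S ⟶ S} {p : S ⟶ Sbar} (h : σ ≫ p = p) (πbar : Sbar ⟶ X)
    (U : X.Opens) :
    letI := ((p ≫ πbar).app U).hom.toAlgebra
    Γ(S, (p ≫ πbar) ⁻¹ᵁ U) →ₐ[Γ(X, U)] Γ(S, (p ≫ πbar) ⁻¹ᵁ U) :=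
  letI := ((p ≫ πbar).app U).hom.toAlgebra
  { sectionAction h (πbar ⁻¹ᵁ U) with
    commutes' := fun a => by
      have h1 : ((p ≫ πbar).app U) a = p.app _ (πbar.app U a) :=
        congr($(Scheme.Hom.comp_app p πbar U) a)
      exact (congrArg _ h1).trans ((sectionAction_app h _ _).trans h1.symm) }

theorem finite_app_of_comp_finite {p : S ⟶ Sbar} {πbar : Sbar ⟶ X} {U : X.Opens}
    [IsNoetherianRing Γ(X, U)] (hinj : Function.Injective (p.app (πbar ⁻¹ᵁ U)))
    (hf : ((p ≫ πbar).app U).hom.Finite) : (πbar.app U).hom.Finite := by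
  let := (πbar.app U).hom.toAlgebra
  let := ((p ≫ πbar).app U).hom.toAlgebra
  let φ : Γ(Sbar, πbar ⁻¹ᵁ U) →ₐ[Γ(X, U)] Γ(S, (p ≫ πbar) ⁻¹ᵁ U) :=
    { (p.app (πbar ⁻¹ᵁ U)).hom with
      commutes' := fun a => congr($(Scheme.Hom.comp_app p πbar U) a).symm }
  have : Module.Finite Γ(X, U) Γ(S, (p ≫ πbar) ⁻¹ᵁ U) := hf
  exact Module.Finite.of_injective φ.toLinearMap hinj

theorem isSpectralCover [IsIntegral X] [Smooth s] [SmoothOfRelativeDimension 1 s]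
    {m : ℕ} (hm : 1 ≤ m) {b : ∀ i : ℕ, CanonicalSection s (2 * i)}
    {pm : CanonicalSection s m} (hpm : pm.HasSimpleZeros)
    (hb : 2 ≤ m → ∀ x : X, pm.VanishesAt x → ¬ (b (m - 1)).VanishesAt x)
    {S' : Scheme.{0}} [IsReduced S'] {π' : S' ⟶ X} {lam : PullbackSection s π'}
    (hS' : IsSpectralCurve m b pm π' lam) {μ : S ⟶ S'} (hμ : IsNormalization μ)
    {σ' : S' ⟶ S'} (hσ' : IsSignInvolution π' lam σ') {σ : S ⟶ S} (hσ : σ ≫ μ = μ ≫ σ')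
    {p : S ⟶ Sbar} (hp : IsQuotient σ p) {πbar : Sbar ⟶ X} (hπbar : p ≫ πbar = μ ≫ π') :
    IsSpectralCover pm σ p πbar (liftCoeff lam μ (p ≫ πbar) hπbar) := by
  have hred := hμ.isReduced
  have := hμ.isIntegralHom
  have := hS'.isAffineHom
  have haff : ∀ U : X.affineOpens, IsAffineOpen (p ⁻¹ᵁ πbar ⁻¹ᵁ U.1) := fun U => by
    have h1 := U.2.preimage (μ ≫ π')
    rw [← hπbar] at h1
    exact h1
  have hanti : ∀ (U : X.affineOpens) (ω : Frame s U.1),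
      sectionAction hp.comp_eq (πbar ⁻¹ᵁ U.1) (liftCoeff lam μ (p ≫ πbar) hπbar U ω) =
        -liftCoeff lam μ (p ≫ πbar) hπbar U ω := fun U ω => by
    have e' : π' ⁻¹ᵁ U.1 ≤ σ' ⁻¹ᵁ (π' ⁻¹ᵁ U.1) := preimage_le_of_comp_eq hσ'.comp_eq _
    have e : (p ≫ πbar) ⁻¹ᵁ U.1 ≤ μ ⁻¹ᵁ (π' ⁻¹ᵁ U.1) := by rw [hπbar]; rfl
    have eσ : (p ≫ πbar) ⁻¹ᵁ U.1 ≤ σ ⁻¹ᵁ ((p ≫ πbar) ⁻¹ᵁ U.1) :=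
      preimage_le_of_comp_eq hp.comp_eq (πbar ⁻¹ᵁ U.1)
    have h0 : ∀ (f g : S ⟶ S') (hfg : f = g) (e₁ : (p ≫ πbar) ⁻¹ᵁ U.1 ≤ f ⁻¹ᵁ (π' ⁻¹ᵁ U.1))
      (e₂ : (p ≫ πbar) ⁻¹ᵁ U.1 ≤ g ⁻¹ᵁ (π' ⁻¹ᵁ U.1)), f.appLE _ _ e₁ = g.appLE _ _ e₂ := by
      rintro _ _ rfl _ _
      rfl
    have h1 := h0 _ _ hσ (eσ.trans (σ.preimage_mono e)) (e.trans (μ.preimage_mono e'))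
    rw [← Scheme.Hom.appLE_comp_appLE σ μ _ _ _ e eσ,
      ← Scheme.Hom.appLE_comp_appLE μ σ' _ _ _ e' e] at h1
    have h2 := congr($h1 (lam.coeff U ω))
    rw [CommRingCat.comp_apply, CommRingCat.comp_apply, hσ'.map_coeff, map_neg] at h2
    exact h2
  have hmodel : ∀ (U : X.affineOpens) [Nonempty U.1] (ω : Frame s U.1), _ :=
    fun U _ ω => spectralModel hS' hm hμ (p ≫ πbar) hπbar U ω
  -- That the lift `σ` is an involution is a consequence of `σ lam = -lam` and torsion-freeness,
  -- over each member of an affine cover.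
  have hsq : σ ≫ σ = 𝟙 S := eq_id_of_appLE_eq_id _ fun x => by
    obtain ⟨U, hx, ⟨ω⟩⟩ := exists_frame s ((p ≫ πbar) x)
    have : Nonempty U.1 := ⟨⟨_, hx⟩⟩
    have eσ := preimage_le_of_comp_eq hp.comp_eq (πbar ⁻¹ᵁ U.1)
    refine ⟨p ⁻¹ᵁ πbar ⁻¹ᵁ U.1, hx, haff U, eσ.trans (σ.preimage_mono eσ), ?_⟩
    rw [← Scheme.Hom.appLE_comp_appLE σ σ _ _ _ eσ eσ]
    ext z
    let := ((p ≫ πbar).app U.1).hom.toAlgebra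
    exact (hmodel U ω).1.involutive (sectionActionAlgHom hp.comp_eq πbar U.1) (hanti U ω) z
  refine ⟨hp, hsq, ?_, fun U _ ω => hpm.coeff_ne_zero U ω, ?_, hanti, fun U _ ω =>
    ⟨_, (quotientPolynomial_natDegree_monic m b pm U ω hm).1,
      quotientPolynomial_coeff_zero m b pm U ω hm, (hmodel U ω).1⟩, ?_, ?_⟩
  · refine isAffineHom_of_forall_exists_isAffineOpen _ fun x => ?_
    obtain ⟨U, hx, -⟩ := exists_frame s x
    exact ⟨U.1, hx, U.2, hp.isAffineOpen hsq (haff U)⟩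
  · intro U V h ω ω' u hu
    rw [liftCoeff_res lam μ _ hπbar U V h ω ω' u hu]
    congr 1
  · intro U _ ω
    let := ((p ≫ πbar).app U.1).hom.toAlgebra
    have h0 := hpm.coeff_ne_zero U ω
    have hg0 := quotientPolynomial_coeff_zero m b pm U ω hm
    obtain ⟨y, hy, c, hc, d, hd, hcd⟩ := (hmodel U ω).1.exists_cofactor h0 hg0
      (isCoprime_coeff_one m b pm U ω hm hb) fun q hq =>
        localization_isIntegrallyClosed_of_stalk hμ.isDomain_stalk hμ.isIntegrallyClosed_stalk
          (haff U) q (hq := hq.isPrime)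
    have hσy := (hmodel U ω).1.map_cofactor h0 hg0 hy
      (sectionActionAlgHom hp.comp_eq πbar U.1) (hanti U ω)
    let τ := sectionActionAlgHom hp.comp_eq πbar U.1
    -- The coefficients `c`, `d` are polynomials in the invariant functions `lam ^ 2` and `y ^ 2`,
    -- so they descend to `Sbar`.
    have hτ : ∀ z ∈ Algebra.adjoin Γ(X, U.1) {liftCoeff lam μ _ hπbar U ω ^ 2, y ^ 2},
        τ z = z := fun z hz => by
      have hle : Algebra.adjoin Γ(X, U.1) {liftCoeff lam μ _ hπbar U ω ^ 2, y ^ 2} ≤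
          AlgHom.equalizer τ (AlgHom.id _ _) := Algebra.adjoin_le fun w hw => by
        obtain rfl | rfl := hw
        · refine (map_pow τ _ 2).trans ?_
          rw [show τ _ = _ from hanti U ω, neg_sq]
          rfl
        · refine (map_pow τ _ 2).trans ?_
          rw [show τ _ = _ from hσy, neg_sq]
          rfl
      exact hle hz
    obtain ⟨c, rfl⟩ := hp.mem_range_of_sectionAction _ (hτ c hc)
    obtain ⟨d, rfl⟩ := hp.mem_range_of_sectionAction _ (hτ d hd)
    exact ⟨y, hσy, c, d, hcd⟩
  · rintro U _ ⟨ω⟩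
    obtain ⟨_, _, -⟩ := ω.coordinateRing s U
    have := charZero_of_nonempty s U.1
    let := ((p ≫ πbar).app U.1).hom.toAlgebra
    have := (hmodel U ω).2
    have : Module.Finite Γ(X, U.1) Γ(S, (p ≫ πbar) ⁻¹ᵁ U.1) := (hmodel U ω).1.finite
    exact finite_app_of_comp_finite (hp.injective _) this

/-! ### Generators of the eigensheaf and the multiplication pairing -/

section AntiInvariants

variable {S Sbar : Scheme.{0}} {σ : S ⟶ S} {p : S ⟶ Sbar}

theorem isUnit_of_locally_isUnit {Y : Scheme.{0}} {U : Y.Opens} (f : Γ(Y, U))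
    (h : ∀ y ∈ U, ∃ (V : Y.Opens) (i : V ≤ U), y ∈ V ∧ IsUnit (Y.presheaf.map (homOfLE i).op f)) :
    IsUnit f := by
  refine Y.toRingedSpace.isUnit_of_isUnit_germ U f fun y hy => ?_
  obtain ⟨V, i, hyV, hV⟩ := h y hy
  have h1 := hV.map (Y.presheaf.germ V y hyV).hom
  rw [Y.presheaf.germ_res_apply] at h1
  exact h1

theorem IsQuotient.isUnit_of_isUnit_app (hp : IsQuotient σ p) {V : Sbar.Opens} {f : Γ(Sbar, V)}
    (h : IsUnit (p.app V f)) : IsUnit f := by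
  obtain ⟨g, hg⟩ := h.exists_right_inv
  obtain ⟨g, rfl⟩ := hp.mem_range_of_sectionAction V (f := g) (h.mul_left_cancel (by
    have h1 := congrArg (sectionAction hp.comp_eq V) hg
    rw [map_mul, sectionAction_app, map_one] at h1
    rw [h1, hg]))
  refine .of_mul_eq_one g (hp.injective V ?_)
  rw [map_mul, hg, map_one]

theorem sectionAction_antiInvariantsIncl (h : σ ≫ p = p) {U : Sbar.Opens}
    (l : Γ(antiInvariants σ p h, U)) :
    sectionAction h U (antiInvariantsIncl h U l) = -antiInvariantsIncl h U l :=
  ((antiInvariantsIncl_isKernel h U).2 _).mpr ⟨l, rfl⟩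

/-- The inverse of an invertible anti-invariant function is anti-invariant, so the quotient of any
section of `ℒ` by it is an invariant function. -/
theorem IsQuotient.isGenerator_of_isUnit (hp : IsQuotient σ p) {U : Sbar.Opens}
    {l : Γ(antiInvariants σ p hp.comp_eq, U)} (hl : IsUnit (antiInvariantsIncl hp.comp_eq U l)) :
    IsGenerator (antiInvariants σ p hp.comp_eq) l := by
  intro V i
  have hlV := hl.map (S.presheaf.map (homOfLE (p.preimage_mono i)).op).hom
  replace hlV : IsUnit (antiInvariantsIncl hp.comp_eq V
    ((antiInvariants σ p hp.comp_eq).presheaf.map (homOfLE i).op l)) := by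
      rw [antiInvariantsIncl_res]
      exact hlV
  generalize (antiInvariants σ p hp.comp_eq).presheaf.map (homOfLE i).op l = l' at *
  refine ⟨fun a a' haa' => ?_, fun x => ?_⟩
  · have h1 := congrArg (antiInvariantsIncl hp.comp_eq V) haa'
    simp only [antiInvariantsIncl_smul] at h1
    exact hp.injective V (hlV.mul_right_cancel h1)
  · obtain ⟨g, hg⟩ := hlV.exists_left_inv
    obtain ⟨a, ha⟩ := hp.mem_range_of_sectionAction V (f := antiInvariantsIncl hp.comp_eq V x * g) (by
      have h1 := congrArg (sectionAction hp.comp_eq V) hg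
      rw [map_mul, sectionAction_antiInvariantsIncl, map_one, ← hg] at h1
      have h2 : sectionAction hp.comp_eq V g = -g := hlV.mul_right_cancel (by
        linear_combination -h1)
      rw [map_mul, sectionAction_antiInvariantsIncl, h2, neg_mul_neg])
    refine ⟨a, (antiInvariantsIncl_isKernel hp.comp_eq V).1 ?_⟩
    simp only [antiInvariantsIncl_smul, ha]
    rw [mul_assoc, hg, mul_one]

/-- The product of two sections of `ℒ`, a function on `Sbar`. -/
theorem IsQuotient.exists_app_eq_mul (hp : IsQuotient σ p) (U : Sbar.Opens)
    (x y : Γ(S, p ⁻¹ᵁ U)) (hx : sectionAction hp.comp_eq U x = -x)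
    (hy : sectionAction hp.comp_eq U y = -y) : ∃ a, p.app U a = x * y :=
  hp.mem_range_of_sectionAction U (by rw [map_mul, hx, hy, neg_mul_neg])

/-- The multiplication pairing `ℒ × ℒ → 𝒪`. -/
def IsQuotient.pairing (hp : IsQuotient σ p) (U : Sbar.Opens)
    (a b : Γ(antiInvariants σ p hp.comp_eq, U)) : Γ(Sbar, U) :=
  (hp.exists_app_eq_mul U _ _ (sectionAction_antiInvariantsIncl hp.comp_eq a)
    (sectionAction_antiInvariantsIncl hp.comp_eq b)).choose

theorem IsQuotient.app_pairing (hp : IsQuotient σ p) (U : Sbar.Opens)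
    (a b : Γ(antiInvariants σ p hp.comp_eq, U)) : p.app U (hp.pairing U a b) =
      antiInvariantsIncl hp.comp_eq U a * antiInvariantsIncl hp.comp_eq U b :=
  (hp.exists_app_eq_mul U _ _ (sectionAction_antiInvariantsIncl hp.comp_eq a)
    (sectionAction_antiInvariantsIncl hp.comp_eq b)).choose_spec

theorem antiInvariantsIncl_add (h : σ ≫ p = p) (U : Sbar.Opens)
    (a b : Γ(antiInvariants σ p h, U)) : antiInvariantsIncl h U (a + b) =
      antiInvariantsIncl h U a + antiInvariantsIncl h U b :=
  map_add _ _ _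

/-- Every point of `Sbar` has a neighbourhood with an invertible anti-invariant function. -/
def HasLocalUnits (h : σ ≫ p = p) : Prop :=
  ∀ y : Sbar, ∃ U : Sbar.Opens, y ∈ U ∧
    ∃ e : Γ(antiInvariants σ p h, U), IsUnit (antiInvariantsIncl h U e)

/-- Near each point there is an invertible section of `ℒ`; it is a multiple of the generator `e`, so
`e` is invertible as well. -/
theorem IsQuotient.isUnit_of_isGenerator (hp : IsQuotient σ p) (hu : HasLocalUnits hp.comp_eq)
    {U : Sbar.Opens} {e : Γ(antiInvariants σ p hp.comp_eq, U)}
    (he : IsGenerator (antiInvariants σ p hp.comp_eq) e) :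
    IsUnit (antiInvariantsIncl hp.comp_eq U e) := by
  refine isUnit_of_locally_isUnit _ fun x hx => ?_
  obtain ⟨V, hxV, e', he'⟩ := hu (p x)
  refine ⟨p ⁻¹ᵁ (V ⊓ U), p.preimage_mono inf_le_right, ⟨hxV, hx⟩, ?_⟩
  obtain ⟨a, ha⟩ := (he (V ⊓ U) inf_le_right).2
    ((antiInvariants σ p hp.comp_eq).presheaf.map (homOfLE inf_le_left).op e')
  have h1 := congrArg (antiInvariantsIncl hp.comp_eq _) ha
  simp only [antiInvariantsIncl_smul, antiInvariantsIncl_res] at h1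
  refine isUnit_of_mul_isUnit_right (x := p.app _ a) ?_
  rw [h1]
  exact he'.map (S.presheaf.map (homOfLE (p.preimage_mono inf_le_left)).op).hom

theorem IsQuotient.isTwoTorsion (hp : IsQuotient σ p) (hu : HasLocalUnits hp.comp_eq) :
    IsTwoTorsion (antiInvariants σ p hp.comp_eq) := by
  refine ⟨fun U => LinearMap.mk₂ _ (hp.pairing U) ?_ ?_ ?_ ?_, ?_, ?_⟩
  · intro a a' b
    refine hp.injective U ?_
    rw [map_add]
    simp only [hp.app_pairing, antiInvariantsIncl_add, add_mul]
  · intro c a b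
    refine hp.injective U ?_
    rw [smul_eq_mul, map_mul]
    simp only [hp.app_pairing, antiInvariantsIncl_smul, mul_assoc]
  · intro a b b'
    refine hp.injective U ?_
    rw [map_add]
    simp only [hp.app_pairing, antiInvariantsIncl_add, mul_add]
  · intro c a b
    refine hp.injective U ?_
    rw [smul_eq_mul, map_mul]
    simp only [hp.app_pairing, antiInvariantsIncl_smul]
    ring
  · intro U V h a b
    refine hp.injective V ?_
    simp only [LinearMap.mk₂_apply, hp.app_pairing, antiInvariantsIncl_res]
    rw [← map_mul, ← hp.app_pairing]
    exact congr($(p.naturality (homOfLE h).op) (hp.pairing U a b)).symm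
  · intro U e he
    refine hp.isUnit_of_isUnit_app ?_
    rw [LinearMap.mk₂_apply, hp.app_pairing]
    have := hp.isUnit_of_isGenerator hu he
    exact this.mul this

end AntiInvariants

/-! ### Étaleness, finiteness and flatness -/

theorem isFinite_of_iSup_eq_top {X Y : Scheme.{0}} {f : X ⟶ Y} {ι : Type*}
    (U : ι → Y.affineOpens) (h : ⨆ i, (U i : Y.Opens) = ⊤)
    (hf : ∀ i, IsAffineOpen (f ⁻¹ᵁ (U i).1) ∧ (f.app (U i).1).hom.Finite) : IsFinite f := by
  have : HasAffineProperty @IsFinite (affineAnd RingHom.Finite) :=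
    (HasAffineProperty.affineAnd_iff _ RingHom.finite_respectsIso
      RingHom.finite_localizationPreserves.away RingHom.finite_ofLocalizationSpan).mpr
      fun f => by rw [isFinite_iff, isAffineHom_iff]
  refine (HasAffineProperty.iff_of_iSup_eq_top (P := @IsFinite) (Q := affineAnd RingHom.Finite)
    U h).mpr fun i => ⟨(hf i).1, ?_⟩
  have h1 := congrArg CommRingCat.Hom.hom (morphismRestrict_appTop f (U i).1)
  have key : ∀ V : Y.Opens, V = U i → ∀ W (e : W = f ⁻¹ᵁ V),
      RingHom.Finite ((f.app V) ≫ X.presheaf.map (eqToHom e).op).hom := by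
    rintro _ rfl _ rfl
    simpa using (hf i).2
  exact h1 ▸ key _ (Scheme.Opens.ι_image_top _) _ (image_morphismRestrict_preimage f (U i).1 ⊤)

theorem etale_holdsForLocalizationAway :
    RingHom.HoldsForLocalizationAway RingHom.Etale := by
  introv R _
  rw [RingHom.etale_algebraMap]
  exact Algebra.Etale.of_isLocalizationAway r

namespace IsSpectralCover

variable {X : Scheme.{0}} {s : X ⟶ Spec (CommRingCat.of ℂ)} {S Sbar : Scheme.{0}} {m : ℕ}
  {pm : CanonicalSection s m} {σ : S ⟶ S} {p : S ⟶ Sbar} {πbar : Sbar ⟶ X}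
  {lam : ∀ U : X.affineOpens, Frame s U.1 → Γ(S, p ⁻¹ᵁ πbar ⁻¹ᵁ U.1)}
  (hc : IsSpectralCover pm σ p πbar lam) [SmoothOfRelativeDimension 1 s]
include hc

theorem hasLocalUnits : HasLocalUnits hc.quotient.comp_eq := by
  intro y
  obtain ⟨U, hy, ⟨ω⟩⟩ := exists_frame s (πbar y)
  have : Nonempty U.1 := ⟨⟨_, hy⟩⟩
  obtain ⟨z, hz, c, d, hcd⟩ := hc.cofactor U ω
  have hp := hc.quotient
  obtain ⟨t, ht⟩ := hp.exists_app_eq_mul _ _ _ (hc.lam_anti U ω) (hc.lam_anti U ω)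
  obtain ⟨t', ht'⟩ := hp.exists_app_eq_mul _ _ _ hz hz
  have key : ∀ (z : Γ(S, p ⁻¹ᵁ πbar ⁻¹ᵁ U.1)) (t : Γ(Sbar, πbar ⁻¹ᵁ U.1)),
      sectionAction hp.comp_eq _ z = -z → p.app _ t = z * z →
        IsUnit (Sbar.presheaf.germ (πbar ⁻¹ᵁ U.1) y hy t) →
        ∃ U : Sbar.Opens, y ∈ U ∧
    ∃ e : Γ(antiInvariants σ p hp.comp_eq, U), IsUnit (antiInvariantsIncl hp.comp_eq U e) := by
    intro z t hz ht hy
    refine ⟨Sbar.basicOpen t, (Sbar.mem_basicOpen t y _).mpr hy, ?_⟩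
    obtain ⟨e, rfl⟩ := ((antiInvariantsIncl_isKernel hp.comp_eq _).2 _).mp hz
    refine ⟨(antiInvariants σ p hp.comp_eq).presheaf.map (homOfLE (Sbar.basicOpen_le t)).op e, ?_⟩
    rw [antiInvariantsIncl_res]
    refine isUnit_of_mul_isUnit_left (y := S.presheaf.map
      (homOfLE (p.preimage_mono (Sbar.basicOpen_le t))).op (antiInvariantsIncl hp.comp_eq _ e)) ?_
    rw [← map_mul, ← ht]
    have h1 := (Sbar.toRingedSpace.isUnit_res_basicOpen t).map (p.app (Sbar.basicOpen t)).hom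
    have h2 := congr($(p.naturality (homOfLE (Sbar.basicOpen_le t)).op) t)
    rw [CommRingCat.comp_apply] at h2
    erw [h2] at h1
    exact h1
  have hsum : c * t + d * t' = 1 := hp.injective _ (by
    rw [map_add, map_mul, map_mul, ht, ht', map_one, ← hcd]
    ring)
  have h1 := congrArg (Sbar.presheaf.germ (πbar ⁻¹ᵁ U.1) y hy) hsum
  rw [map_add, map_mul, map_mul, map_one] at h1
  -- In the local ring at `y`, one summand of `c lam ^ 2 + d z ^ 2 = 1` is a unit, so `lam` or `z`
  -- is invertible near `y`.
  obtain h2 | h2 := IsLocalRing.isUnit_or_isUnit_of_add_one h1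
  · exact key _ t (hc.lam_anti U ω) ht (isUnit_of_mul_isUnit_right h2)
  · exact key _ t' hz ht' (isUnit_of_mul_isUnit_right h2)

theorem isLineBundle : IsLineBundle (antiInvariants σ p hc.quotient.comp_eq) := fun y => by
  obtain ⟨U, hy, e, he⟩ := hc.hasLocalUnits y
  exact ⟨U, hy, e, hc.quotient.isGenerator_of_isUnit he⟩

theorem etale : Etale p := by
  have := hc.isAffineHom
  have hp := hc.quotient
  have := hp.isAffineHom
  rw [HasRingHomProperty.iff_exists_appLE (P := @Etale)
    (RingHom.Etale.stableUnderComposition.stableUnderCompositionWithLocalizationAway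
      etale_holdsForLocalizationAway).left]
  intro x
  obtain ⟨U, hx, ⟨ω⟩⟩ := exists_frame s (πbar (p x))
  have : Nonempty U.1 := ⟨⟨_, hx⟩⟩
  have hW := U.2.preimage πbar
  refine ⟨⟨_, hW⟩, ⟨_, hW.preimage p⟩, hx, le_rfl, ?_⟩
  rw [Scheme.Hom.appLE_eq_app]
  let := (p.app (πbar ⁻¹ᵁ U.1)).hom.toAlgebra
  obtain ⟨z, hz, c, d, hcd⟩ := hc.cofactor U ω
  let τ : Γ(S, p ⁻¹ᵁ πbar ⁻¹ᵁ U.1) →ₐ[Γ(Sbar, πbar ⁻¹ᵁ U.1)] Γ(S, p ⁻¹ᵁ πbar ⁻¹ᵁ U.1) :=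
    { sectionAction hp.comp_eq (πbar ⁻¹ᵁ U.1) with
      commutes' := sectionAction_app hp.comp_eq _ }
  refine etale_of_antiInvariant (C := Γ(Sbar, πbar ⁻¹ᵁ U.1)) (hp.injective _) τ
    (fun b hb => hp.mem_range_of_sectionAction _ hb)
    (sectionAction_involutive hp.comp_eq hc.sq _) ?_ (lam U ω) z (hc.lam_anti U ω) hz c d hcd
  have h2 := (isUnit_natCast s U.1 2 two_ne_zero).map (πbar.app U.1).hom
  rwa [map_natCast] at h2

theorem isFinite : IsFinite πbar := by
  have := hc.isAffineHom
  choose U hU hω using exists_frame s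
  refine isFinite_of_iSup_eq_top U (top_le_iff.mp fun x _ => by simpa using ⟨x, hU x⟩) fun x => ?_
  have : Nonempty (U x).1 := ⟨⟨x, hU x⟩⟩
  exact ⟨(U x).2.preimage πbar, hc.finite (U x) (hω x)⟩

omit [SmoothOfRelativeDimension 1 s] in
theorem isTorsionFree (U : X.affineOpens) [Nonempty U.1] (ω : Frame s U.1) :
    letI := (πbar.app U.1).hom.toAlgebra
    Module.IsTorsionFree Γ(X, U.1) Γ(Sbar, πbar ⁻¹ᵁ U.1) := by
  let := (πbar.app U.1).hom.toAlgebra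
  let := ((p ≫ πbar).app U.1).hom.toAlgebra
  obtain ⟨g, -, -, hg⟩ := hc.model U ω
  have := hg.isTorsionFree
  let φ : Γ(Sbar, πbar ⁻¹ᵁ U.1) →ₐ[Γ(X, U.1)] Γ(S, (p ≫ πbar) ⁻¹ᵁ U.1) :=
    { (p.app (πbar ⁻¹ᵁ U.1)).hom with
      commutes' := fun a => congr($(Scheme.Hom.comp_app p πbar U.1) a).symm }
  exact Function.Injective.moduleIsTorsionFree φ (hc.quotient.injective _) (map_smul φ)

theorem flat [IsIntegral X] [Smooth s] : Flat πbar := by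
  have := hc.isAffineHom
  rw [HasRingHomProperty.iff_exists_appLE (P := @Flat)
    (RingHom.Flat.stableUnderComposition.stableUnderCompositionWithLocalizationAway
      RingHom.Flat.holdsForLocalizationAway).left]
  intro x
  obtain ⟨U, hx, ⟨ω⟩⟩ := exists_frame s (πbar x)
  have : Nonempty U.1 := ⟨⟨_, hx⟩⟩
  refine ⟨U, ⟨_, U.2.preimage πbar⟩, hx, le_rfl, ?_⟩
  rw [Scheme.Hom.appLE_eq_app]
  let := (πbar.app U.1).hom.toAlgebra
  have := hc.isTorsionFree U ω
  exact (ω.coordinateRing s U).2.2 Γ(Sbar, πbar ⁻¹ᵁ U.1)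

end IsSpectralCover

/-! ### Local freeness and restriction of norms of functions -/

/-- A finite flat module over a noetherian ring is free at `P`, and by finite presentation it is
then free on a basic open neighbourhood. -/
theorem exists_away_free {A C : Type*} [CommRing A] [AddCommGroup C] [Module A C]
    [IsNoetherianRing A] [Module.Finite A C] [Module.Flat A C] (P : Ideal A) [P.IsPrime] :
    ∃ r ∉ P, Module.Free (Localization.Away r) (LocalizedModule.Away r C) := by
  have : Module.FinitePresentation A C := Module.finitePresentation_of_finite A C
  have : Module.Free (Localization.AtPrime P) (LocalizedModule.AtPrime P C) :=
    Module.free_of_flat_of_isLocalRing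
  obtain ⟨r, hr, h, -⟩ := Module.FinitePresentation.exists_free_localizedModule_powers
    P.primeCompl (LocalizedModule.mkLinearMap P.primeCompl C) (Localization.AtPrime P)
  exact ⟨r, hr, h⟩

theorem free_of_isLocalizedModule {A M A' M' : Type*} [CommRing A] [AddCommGroup M] [Module A M]
    [CommRing A'] [Algebra A A'] [AddCommGroup M'] [Module A M'] [Module A' M']
    [IsScalarTower A A' M'] (S : Submonoid A) (f : M →ₗ[A] M') [IsLocalization S A']
    [IsLocalizedModule S f] [Module.Free (Localization S) (LocalizedModule S M)] :
    Module.Free A' M' := by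
  let e₁ : Localization S ≃ₐ[A] A' := IsLocalization.algEquiv S _ _
  let e₂ : LocalizedModule S M ≃ₗ[A] M' := IsLocalizedModule.iso S f
  have := RingHomInvPair.of_ringEquiv e₁.toRingEquiv
  have := RingHomInvPair.of_ringEquiv e₁.toRingEquiv.symm
  let e : LocalizedModule S M ≃ₛₗ[(e₁.toRingEquiv : Localization S →+* A')] M' :=
    { e₂ with
      map_smul' := fun x z => by
        obtain ⟨a, t, rfl⟩ := IsLocalization.exists_mk'_eq S x
        refine IsLocalizedModule.smul_injective f t ?_
        change t.1 • e₂ _ = t.1 • (e₁ (IsLocalization.mk' _ a t) • e₂ z)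
        rw [← map_smul, ← smul_assoc, ← smul_assoc, ← map_smul e₁, Algebra.smul_def t.1,
          IsLocalization.mk'_spec', AlgEquiv.commutes, algebraMap_smul, algebraMap_smul, map_smul] }
  exact Module.Free.of_equiv e

section Scheme

variable {X Y : Scheme.{0}} (π : Y ⟶ X)

theorem res_res {U V W : X.Opens} (h : V ≤ U) (h' : W ≤ V) (f : Γ(X, U)) :
    X.presheaf.map (homOfLE h').op (X.presheaf.map (homOfLE h).op f) =
      X.presheaf.map (homOfLE (h'.trans h)).op f := by
  rw [← CommRingCat.comp_apply, ← X.presheaf.map_comp]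
  rfl

theorem app_res {U V : X.Opens} (h : V ≤ U) (f : Γ(X, U)) :
    π.app V (X.presheaf.map (homOfLE h).op f) =
      Y.presheaf.map (homOfLE (π.preimage_mono h)).op (π.app U f) :=
  congr($(π.naturality (homOfLE h).op) f)

/-- The coordinate ring of `π⁻¹ D(f)`, as a localization of the one of `π⁻¹ W`. -/
theorem isLocalization_preimage_basicOpen [IsAffineHom π] {W : X.Opens} (hW : IsAffineOpen W)
    (f : Γ(X, W)) :
    letI := (π.app W).hom.toAlgebra
    letI := (Y.presheaf.map (homOfLE (π.preimage_mono (X.basicOpen_le f))).op).hom.toAlgebra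
    IsLocalization (Algebra.algebraMapSubmonoid Γ(Y, π ⁻¹ᵁ W) (.powers f))
      Γ(Y, π ⁻¹ᵁ X.basicOpen f) := by
  let := (π.app W).hom.toAlgebra
  let := (Y.presheaf.map (homOfLE (π.preimage_mono (X.basicOpen_le f))).op).hom.toAlgebra
  rw [Algebra.algebraMapSubmonoid_powers]
  exact (hW.preimage π).isLocalization_of_eq_basicOpen _ _ (Scheme.preimage_basicOpen π f)

theorem functionNorm_res_basicOpen [IsFinite π] {W D : X.Opens} (hW : IsAffineOpen W)
    (hfree : IsFreeOver π W) (h : D ≤ W) (hD : ∃ f : Γ(X, W), D = X.basicOpen f)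
    (a : Γ(Y, π ⁻¹ᵁ W)) :
    functionNorm π D (Y.presheaf.map (homOfLE (π.preimage_mono h)).op a) =
      X.presheaf.map (homOfLE h).op (functionNorm π W a) := by
  obtain ⟨f, rfl⟩ := hD
  let A := Γ(X, W)
  let A' := Γ(X, X.basicOpen f)
  let C := Γ(Y, π ⁻¹ᵁ W)
  let C' := Γ(Y, π ⁻¹ᵁ X.basicOpen f)
  let : Algebra A C := (π.app W).hom.toAlgebra
  let : Algebra A' C' := (π.app (X.basicOpen f)).hom.toAlgebra
  let : Algebra C C' :=
    (Y.presheaf.map (homOfLE (π.preimage_mono (X.basicOpen_le f))).op).hom.toAlgebra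
  let : Algebra A C' := ((algebraMap C C').comp (algebraMap A C)).toAlgebra
  have : IsScalarTower A C C' := .of_algebraMap_eq fun _ => rfl
  have : IsScalarTower A A' C' := .of_algebraMap_eq fun x =>
    (app_res π (X.basicOpen_le f) x).symm
  have : IsLocalization.Away f A' := hW.isLocalization_basicOpen f
  have : IsLocalization (Algebra.algebraMapSubmonoid C (.powers f)) C' :=
    isLocalization_preimage_basicOpen π hW f
  have : Module.Free A C := hfree
  have : Module.Finite A C := IsFinite.finite_app π W hW
  exact Algebra.norm_localization A (.powers f) a

/-- An inclusion of affine opens is not a localization in general. The claim is checked on opens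
that are basic both in `W` and in `V`. -/
theorem functionNorm_res [IsFinite π] {W V : X.Opens} (hW : IsAffineOpen W)
    (hfree : IsFreeOver π W) (hV : IsAffineOpen V) (hfree' : IsFreeOver π V) (h : V ≤ W)
    (a : Γ(Y, π ⁻¹ᵁ W)) :
    functionNorm π V (Y.presheaf.map (homOfLE (π.preimage_mono h)).op a) =
      X.presheaf.map (homOfLE h).op (functionNorm π W a) := by
  refine TopCat.Presheaf.section_ext X.sheaf V _ _ fun x hx => ?_
  obtain ⟨f, g, hfg, hxf⟩ := exists_basicOpen_le_affine_inter hW hV x ⟨h hx, hx⟩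
  have h1 : X.basicOpen f ≤ W := X.basicOpen_le f
  have h2 : X.basicOpen f ≤ V := hfg.le.trans (X.basicOpen_le g)
  change X.presheaf.germ V x hx _ = X.presheaf.germ V x hx _
  rw [← X.presheaf.germ_res_apply (homOfLE h2) x hxf, ← X.presheaf.germ_res_apply (homOfLE h2) x hxf,
    res_res, ← functionNorm_res_basicOpen π hW hfree h1 ⟨f, rfl⟩,
    ← functionNorm_res_basicOpen π hV hfree' h2 ⟨g, hfg⟩, res_res]

theorem exists_isFreeOver_basicOpen [IsFinite π] [Flat π] {W : X.Opens} (hW : IsAffineOpen W)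
    [IsNoetherianRing Γ(X, W)] {x : X} (hx : x ∈ W) :
    ∃ f : Γ(X, W), x ∈ X.basicOpen f ∧ IsFreeOver π (X.basicOpen f) := by
  let A := Γ(X, W)
  let C := Γ(Y, π ⁻¹ᵁ W)
  let : Algebra A C := (π.app W).hom.toAlgebra
  have : Module.Finite A C := IsFinite.finite_app π W hW
  have hflat : Module.Flat A C := by
    have h1 := HasRingHomProperty.appLE @Flat π inferInstance ⟨W, hW⟩ ⟨_, hW.preimage π⟩ le_rfl
    rw [Scheme.Hom.appLE_eq_app] at h1
    exact h1
  obtain ⟨f, hf, hfree⟩ := exists_away_free (A := A) (C := C) (hW.primeIdealOf ⟨x, hx⟩).asIdeal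
  refine ⟨f, ?_, ?_⟩
  · rw [← hW.fromSpec_image_basicOpen]
    exact ⟨hW.primeIdealOf ⟨x, hx⟩, hf, hW.fromSpec_primeIdealOf ⟨x, hx⟩⟩
  let A' := Γ(X, X.basicOpen f)
  let C' := Γ(Y, π ⁻¹ᵁ X.basicOpen f)
  let : Algebra A' C' := (π.app (X.basicOpen f)).hom.toAlgebra
  let : Algebra C C' :=
    (Y.presheaf.map (homOfLE (π.preimage_mono (X.basicOpen_le f))).op).hom.toAlgebra
  let : Algebra A C' := ((algebraMap C C').comp (algebraMap A C)).toAlgebra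
  have : IsScalarTower A C C' := .of_algebraMap_eq fun _ => rfl
  have : IsScalarTower A A' C' := .of_algebraMap_eq fun x =>
    (app_res π (X.basicOpen_le f) x).symm
  have : IsLocalization.Away f A' := hW.isLocalization_basicOpen f
  have : IsLocalization (Algebra.algebraMapSubmonoid C (.powers f)) C' :=
    isLocalization_preimage_basicOpen π hW f
  exact free_of_isLocalizedModule (A' := A') (.powers f)
    (IsScalarTower.toAlgHom A C C').toLinearMap

end Scheme

/-! ### The norm map on the eigensheaf -/

variable {X : Scheme.{0}} {s : X ⟶ Spec (CommRingCat.of ℂ)} {S Sbar : Scheme.{0}} {m : ℕ}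
  {pm : CanonicalSection s m} {σ : S ⟶ S} {p : S ⟶ Sbar} {πbar : Sbar ⟶ X}
  {lam : ∀ U : X.affineOpens, Frame s U.1 → Γ(S, p ⁻¹ᵁ πbar ⁻¹ᵁ U.1)}

/-- The function `n` is the norm `Nm(f * lam) / pm` of the anti-invariant function `f`. -/
def IsNormSection (pm : CanonicalSection s m)
    (lam : ∀ U : X.affineOpens, Frame s U.1 → Γ(S, p ⁻¹ᵁ πbar ⁻¹ᵁ U.1)) {U : X.Opens}
    (f : Γ(S, p ⁻¹ᵁ πbar ⁻¹ᵁ U)) (n : Γ(X, U)) : Prop :=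
  ∀ (V : X.affineOpens) [Nonempty V.1] (h : V.1 ≤ U), IsFreeOver πbar V.1 →
    ∀ (ω : Frame s V.1) (z : Γ(Sbar, πbar ⁻¹ᵁ V.1)),
      p.app _ z = S.presheaf.map (homOfLE (p.preimage_mono (πbar.preimage_mono h))).op f * lam V ω →
        functionNorm πbar V.1 z = pm.coeff V ω * X.presheaf.map (homOfLE h).op n

theorem IsNormSection.res {U V : X.Opens} (h : V ≤ U) {f : Γ(S, p ⁻¹ᵁ πbar ⁻¹ᵁ U)} {n : Γ(X, U)}
    (hn : IsNormSection pm lam f n) :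
    IsNormSection pm lam
      (S.presheaf.map (homOfLE (p.preimage_mono (πbar.preimage_mono h))).op f)
      (X.presheaf.map (homOfLE h).op n) := by
  intro W _ hW hfree ω z hz
  rw [res_res] at hz
  rw [res_res, hn W (hW.trans h) hfree ω z hz]

theorem section_eq_of_locally_eq {U : X.Opens} {a b : Γ(X, U)}
    (h : ∀ x ∈ U, ∃ (V : X.Opens) (i : V ≤ U), x ∈ V ∧
      X.presheaf.map (homOfLE i).op a = X.presheaf.map (homOfLE i).op b) : a = b := by
  refine TopCat.Presheaf.section_ext X.sheaf U _ _ fun x hx => ?_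
  obtain ⟨V, i, hxV, hV⟩ := h x hx
  change X.presheaf.germ U x hx a = X.presheaf.germ U x hx b
  rw [← X.presheaf.germ_res_apply (homOfLE i) x hxV, hV, X.presheaf.germ_res_apply]

namespace IsSpectralCover

variable (hc : IsSpectralCover pm σ p πbar lam) [IsIntegral X] [Smooth s]
  [SmoothOfRelativeDimension 1 s]
include hc

/-- Affine open sets with a frame over which `πbar` is free form a basis. -/
theorem exists_isFreeOver {W : X.affineOpens} (ω : Frame s W.1) {O : X.Opens} {x : X}
    (hxW : x ∈ W.1) (hxO : x ∈ O) :
    ∃ (V : X.affineOpens) (h : V.1 ≤ W.1), x ∈ V.1 ∧ V.1 ≤ O ∧ IsFreeOver πbar V.1 ∧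
      (∃ f : Γ(X, W.1), V.1 = X.basicOpen f) ∧
      ∃ ω' : Frame s V.1, ω'.form = resDifferential s h ω.form := by
  have := hc.isFinite
  have := hc.flat
  obtain ⟨g, hg, hxg⟩ := W.2.exists_basicOpen_le ⟨x, hxO⟩ hxW
  have : Nonempty (X.basicOpen g) := ⟨⟨x, hxg⟩⟩
  have hW' : IsAffineOpen (X.basicOpen g) := W.2.basicOpen g
  have := (Frame.coordinateRing s ⟨_, hW'⟩ (ω.restrict s g)).1
  obtain ⟨f, hxf, hf⟩ := exists_isFreeOver_basicOpen πbar hW' hxg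
  obtain ⟨f', hf'⟩ := W.2.basicOpen_basicOpen_is_basicOpen g f
  have hle := X.basicOpen_le f
  exact ⟨⟨_, hW'.basicOpen f⟩, hle.trans (X.basicOpen_le g), hxf, hle.trans hg, hf, ⟨f', hf'.symm⟩,
    ω.exists_restrict s _ ⟨f', hf'.symm⟩⟩

theorem exists_free_nhds {U : X.Opens} {x : X} (hx : x ∈ U) :
    ∃ V : X.affineOpens, x ∈ V.1 ∧ V.1 ≤ U ∧ IsFreeOver πbar V.1 ∧
      Nonempty (Frame s V.1) := by
  obtain ⟨W, hxW, ⟨ω⟩⟩ := exists_frame s x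
  obtain ⟨V, -, hxV, hVU, hV, -, ω', -⟩ := hc.exists_isFreeOver ω hxW hx
  exact ⟨V, hxV, hVU, hV, ⟨ω'⟩⟩

omit [IsIntegral X] [Smooth s] [SmoothOfRelativeDimension 1 s] in
theorem sectionAction_res {U V : X.Opens} (h : V ≤ U) {f : Γ(S, p ⁻¹ᵁ πbar ⁻¹ᵁ U)}
    (hf : sectionAction hc.quotient.comp_eq _ f = -f) :
    sectionAction hc.quotient.comp_eq _
      (S.presheaf.map (homOfLE (p.preimage_mono (πbar.preimage_mono h))).op f) =
      -S.presheaf.map (homOfLE (p.preimage_mono (πbar.preimage_mono h))).op f := by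
  rw [SpectralNorm.sectionAction_res hc.quotient.comp_eq (πbar.preimage_mono h), hf, map_neg]

theorem isNormSection_of_locally {U : X.Opens} {f : Γ(S, p ⁻¹ᵁ πbar ⁻¹ᵁ U)} {n : Γ(X, U)}
    (h : ∀ x ∈ U, ∃ (V : X.Opens) (i : V ≤ U), x ∈ V ∧
      IsNormSection pm lam (S.presheaf.map (homOfLE (p.preimage_mono (πbar.preimage_mono i))).op f)
        (X.presheaf.map (homOfLE i).op n)) : IsNormSection pm lam f n := by
  have := hc.isFinite
  intro W _ hW hfree ω z hz
  refine section_eq_of_locally_eq fun x hx => ?_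
  obtain ⟨O, i, hxO, hO⟩ := h x (hW hx)
  obtain ⟨V, hVW, hxV, hVO, hV, -, ω', hω'⟩ := hc.exists_isFreeOver ω hx hxO
  have : Nonempty V.1 := ⟨⟨x, hxV⟩⟩
  refine ⟨V.1, hVW, hxV, ?_⟩
  -- The frame on `V` is the restriction of `ω`, so the transition function is `1` and the
  -- coefficients simply restrict.
  have hone : resDifferential s hVW ω.form = (1 : Γ(X, V.1)) • ω'.form := by
    rw [hω', one_smul]
  have h1 := hc.lam_res W V hVW ω ω' 1 hone
  have h2 := pm.coeff_res W V hVW ω ω' 1 hone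
  rw [map_one, map_one, one_mul] at h1
  rw [one_pow, one_mul] at h2
  rw [← functionNorm_res πbar W.2 hfree V.2 hV hVW, map_mul, ← h2,
    hO V hVO hV ω' (Sbar.presheaf.map (homOfLE (πbar.preimage_mono hVW)).op z) ?_]
  · rw [res_res, res_res]
  · rw [app_res, hz, map_mul, res_res, res_res, h1]

/-- Locally `n` is determined by `Nm(f * lam) = pm * n`, since `pm` is nonzero in a domain. -/
theorem isNormSection_unique {U : X.Opens} {f : Γ(S, p ⁻¹ᵁ πbar ⁻¹ᵁ U)}
    (hf : sectionAction hc.quotient.comp_eq _ f = -f) {n n' : Γ(X, U)}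
    (hn : IsNormSection pm lam f n) (hn' : IsNormSection pm lam f n') : n = n' := by
  refine section_eq_of_locally_eq fun x hx => ?_
  obtain ⟨V, hxV, hVU, hV, ⟨ω⟩⟩ := hc.exists_free_nhds hx
  have : Nonempty V.1 := ⟨⟨x, hxV⟩⟩
  refine ⟨V.1, hVU, hxV, mul_left_cancel₀ (hc.coeff_ne_zero V ω) ?_⟩
  obtain ⟨z, hz⟩ := hc.quotient.exists_app_eq_mul _ _ _ (hc.sectionAction_res hVU hf)
    (hc.lam_anti V ω)
  rw [← hn V hVU hV ω z hz, ← hn' V hVU hV ω z hz]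

omit [SmoothOfRelativeDimension 1 s] in
theorem exists_norm_eq {V : X.affineOpens} [Nonempty V.1] (ω : Frame s V.1)
    (hfree : IsFreeOver πbar V.1) {f : Γ(S, p ⁻¹ᵁ πbar ⁻¹ᵁ V.1)}
    (hf : sectionAction hc.quotient.comp_eq _ f = -f) :
    letI := (πbar.app V.1).hom.toAlgebra
    Module.finrank Γ(X, V.1) Γ(Sbar, πbar ⁻¹ᵁ V.1) = m ∧
      ∃ (z : Γ(Sbar, πbar ⁻¹ᵁ V.1)) (n : Γ(X, V.1)), p.app _ z = f * lam V ω ∧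
        functionNorm πbar V.1 z = pm.coeff V ω * n ∧ (IsUnit f → IsUnit n) := by
  let A := Γ(X, V.1)
  let B := Γ(S, (p ≫ πbar) ⁻¹ᵁ V.1)
  let C := Γ(Sbar, πbar ⁻¹ᵁ V.1)
  let : Algebra A C := (πbar.app V.1).hom.toAlgebra
  let : Algebra A B := ((p ≫ πbar).app V.1).hom.toAlgebra
  let : Algebra C B := (p.app (πbar ⁻¹ᵁ V.1)).hom.toAlgebra
  have : IsScalarTower A C B := .of_algebraMap_eq fun a =>
    congr($(Scheme.Hom.comp_app p πbar V.1) a)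
  have : Module.Free A C := hfree
  have : Module.Finite A C := hc.finite V ⟨ω⟩
  have := charZero_of_nonempty s V.1
  have : IsIntegrallyClosed A := (ω.coordinateRing s V).2.1
  obtain ⟨g, hgm, hg0, hg⟩ := hc.model V ω
  let τ : B →ₐ[A] B := sectionActionAlgHom hc.quotient.comp_eq πbar V.1
  have hC : ∀ c : C, τ (algebraMap C B c) = algebraMap C B c :=
    sectionAction_app hc.quotient.comp_eq _
  have hinj : Function.Injective (algebraMap C B) := hc.quotient.injective _
  have hlam := hc.lam_anti V ω
  obtain ⟨t, ht⟩ := hc.quotient.exists_app_eq_mul _ _ _ hlam hlam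
  obtain ⟨z, hz⟩ := hc.quotient.exists_app_eq_mul _ _ _ hf hlam
  obtain ⟨v, hv⟩ := hc.quotient.exists_app_eq_mul _ _ _ hf hf
  rw [← pow_two] at ht hv
  obtain ⟨n, hn, hn2⟩ := hg.norm_antiInvariant (C := C) two_ne_zero (hc.coeff_ne_zero V ω) hg0 τ
    hlam hinj hC t z v f ht hz hv
  refine ⟨((hg.finrank_and_norm two_ne_zero τ hlam hinj hC t ht).1).trans hgm, z, n, hz, hn,
    fun hfu => ?_⟩
  have hvu : IsUnit v := hc.quotient.isUnit_of_isUnit_app (by rw [hv]; exact hfu.pow 2)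
  rw [← isUnit_pow_iff two_ne_zero, hn2]
  exact (isUnit_one.neg.pow _).mul (hvu.map _)

/-- Independence of the frame: if `ω = u • ω'`, then `lam` is multiplied by `u`, hence `Nm(f * lam)`
by `u ^ m`, the rank being `m`. As a section of `K_X ^ m`, `pm` is multiplied by `u ^ m` too, so the
quotient does not change. -/
theorem exists_isNormSection_of_isFreeOver {W : X.affineOpens} [Nonempty W.1] (ω : Frame s W.1)
    (hfree : IsFreeOver πbar W.1) {f : Γ(S, p ⁻¹ᵁ πbar ⁻¹ᵁ W.1)}
    (hf : sectionAction hc.quotient.comp_eq _ f = -f) :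
    ∃ n : Γ(X, W.1), IsNormSection pm lam f n ∧ (IsUnit f → IsUnit n) := by
  have := hc.isFinite
  obtain ⟨-, z, n, hz, hn, hu⟩ := hc.exists_norm_eq ω hfree hf
  refine ⟨n, ?_, hu⟩
  intro V _ h hV ω' z' hz'
  obtain ⟨u, hu⟩ := ω'.bijective.2 (resDifferential s h ω.form)
  have h1 := hc.lam_res W V h ω ω' u hu.symm
  have h2 := pm.coeff_res W V h ω ω' u hu.symm
  obtain rfl : z' = πbar.app V.1 u * Sbar.presheaf.map (homOfLE (πbar.preimage_mono h)).op z := by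
    refine hc.quotient.injective _ ?_
    rw [hz', map_mul, app_res, hz, h1, map_mul]
    ring
  have hrank := (hc.exists_norm_eq ω' hV (hc.sectionAction_res h hf)).1
  have hmul : functionNorm πbar V.1
      (πbar.app V.1 u * Sbar.presheaf.map (homOfLE (πbar.preimage_mono h)).op z) =
        u ^ m * functionNorm πbar V.1 (Sbar.presheaf.map (homOfLE (πbar.preimage_mono h)).op z) := by
    let := (πbar.app V.1).hom.toAlgebra
    have : Module.Free Γ(X, V.1) Γ(Sbar, πbar ⁻¹ᵁ V.1) := hV
    have h4 : Algebra.norm Γ(X, V.1) (algebraMap _ Γ(Sbar, πbar ⁻¹ᵁ V.1) u) = u ^ m := by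
      rw [Algebra.norm_algebraMap, hrank]
    exact (map_mul (Algebra.norm Γ(X, V.1)) _ _).trans (congrArg (· * _) h4)
  rw [hmul, functionNorm_res πbar W.2 hfree V.2 hV h, hn, h2, map_mul, mul_assoc]

/-- Uniqueness makes the local quotients agree on overlaps, so they glue; being a unit is local. -/
theorem exists_isNormSection {U : X.Opens} {f : Γ(S, p ⁻¹ᵁ πbar ⁻¹ᵁ U)}
    (hf : sectionAction hc.quotient.comp_eq _ f = -f) :
    ∃ n : Γ(X, U), IsNormSection pm lam f n ∧ (IsUnit f → IsUnit n) := by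
  have h1 : ∀ x : U, ∃ V : X.Opens, ∃ (i : V ≤ U) (n : Γ(X, V)), x.1 ∈ V ∧
      IsNormSection pm lam
        (S.presheaf.map (homOfLE (p.preimage_mono (πbar.preimage_mono i))).op f) n ∧
      (IsUnit f → IsUnit n) := fun x => by
    obtain ⟨V, hxV, hVU, hV, ⟨ω⟩⟩ := hc.exists_free_nhds x.2
    have : Nonempty V.1 := ⟨⟨x, hxV⟩⟩
    obtain ⟨n, hn, hu⟩ := hc.exists_isNormSection_of_isFreeOver ω hV (hc.sectionAction_res hVU hf)
    exact ⟨V.1, hVU, n, hxV, hn, fun hfu => hu (hfu.map (S.presheaf.map _).hom)⟩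
  choose V i n hxV hn hu using h1
  obtain ⟨N, hN, -⟩ := X.sheaf.existsUnique_gluing' V U (fun x => homOfLE (i x))
    (fun x hx => TopologicalSpace.Opens.mem_iSup.mpr ⟨⟨x, hx⟩, hxV _⟩) n fun x y => by
      have h2 := (hn x).res (inf_le_left : V x ⊓ V y ≤ V x)
      have h3 := (hn y).res (inf_le_right : V x ⊓ V y ≤ V y)
      rw [res_res] at h2 h3
      exact hc.isNormSection_unique (hc.sectionAction_res (inf_le_left.trans (i x)) hf) h2 h3
  refine ⟨N, hc.isNormSection_of_locally fun x hx => ⟨V ⟨x, hx⟩, i _, hxV _, ?_⟩, fun hfu =>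
    isUnit_of_locally_isUnit N fun x hx => ⟨V ⟨x, hx⟩, i _, hxV _, ?_⟩⟩
  · have h2 := hN ⟨x, hx⟩
    erw [h2]
    exact hn _
  · have h2 := hN ⟨x, hx⟩
    erw [h2]
    exact hu _ hfu

omit [IsIntegral X] [Smooth s] in
theorem isNormSection_mul {W : X.Opens} (hW : IsAffineOpen W) (hfree : IsFreeOver πbar W)
    {f : Γ(S, p ⁻¹ᵁ πbar ⁻¹ᵁ W)} (hf : sectionAction hc.quotient.comp_eq _ f = -f) {n : Γ(X, W)}
    (hn : IsNormSection pm lam f n) (a : Γ(Sbar, πbar ⁻¹ᵁ W)) :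
    IsNormSection pm lam (p.app _ a * f) (functionNorm πbar W a * n) := by
  have := hc.isFinite
  intro V _ h hV ω z hz
  obtain ⟨z', hz'⟩ := hc.quotient.exists_app_eq_mul _ _ _ (hc.sectionAction_res h hf)
    (hc.lam_anti V ω)
  obtain rfl : z = Sbar.presheaf.map (homOfLE (πbar.preimage_mono h)).op a * z' := by
    refine hc.quotient.injective _ ?_
    rw [hz, map_mul, map_mul, app_res, hz', mul_assoc]
  have h1 : functionNorm πbar V.1 (Sbar.presheaf.map (homOfLE (πbar.preimage_mono h)).op a * z') =
      functionNorm πbar V.1 (Sbar.presheaf.map (homOfLE (πbar.preimage_mono h)).op a) *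
        functionNorm πbar V.1 z' := by
    let := (πbar.app V.1).hom.toAlgebra
    exact map_mul (Algebra.norm Γ(X, V.1)) _ _
  rw [h1, functionNorm_res πbar hW hfree V.2 hV h, hn V h hV ω z' hz', map_mul]
  ring

/-- Compatibility with restriction and the rule `N (a e) = Nm(a) N e` both follow from uniqueness.
Generators of `ℒ` are invertible functions, and `N` takes these to units of `𝒪_X`. -/
theorem isNorm : IsNorm πbar (antiInvariants σ p hc.quotient.comp_eq) (structureSheaf X) := by
  let incl := antiInvariantsIncl hc.quotient.comp_eq
  have hanti : ∀ (U : X.Opens) (e : Γ(antiInvariants σ p hc.quotient.comp_eq, πbar ⁻¹ᵁ U)),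
    sectionAction hc.quotient.comp_eq _ (incl _ e) = -incl _ e := fun U e =>
      sectionAction_antiInvariantsIncl _ e
  choose N hN hu using fun (U : X.Opens)
    (e : Γ(antiInvariants σ p hc.quotient.comp_eq, πbar ⁻¹ᵁ U)) =>
      hc.exists_isNormSection (hanti U e)
  refine ⟨N, fun U V h e => ?_, fun W hW hfree a e => ?_, fun U e he V h => ?_⟩
  · refine hc.isNormSection_unique (hanti V _) (hN V _) ?_
    have h1 := (hN U e).res h
    rw [← antiInvariantsIncl_res] at h1
    exact h1
  · refine hc.isNormSection_unique (hanti W _) (hN W _) ?_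
    have h1 := hc.isNormSection_mul hW hfree (hanti W e) (hN W e) a
    rw [← antiInvariantsIncl_smul] at h1
    exact h1
  · have h1 : IsUnit (X.presheaf.map (homOfLE h).op (N U e)) :=
      (hu U e (hc.quotient.isUnit_of_isGenerator hc.hasLocalUnits he)).map (X.presheaf.map _).hom
    change Function.Bijective fun a : Γ(X, V) => a * X.presheaf.map (homOfLE h).op (N U e)
    exact IsUnit.isUnit_iff_mulRight_bijective.mp h1

end IsSpectralCover

end SpectralNorm
end

theorem lemma2p6
    -- the curve `X`
    {X : Scheme.{0}} (s : X ⟶ Spec (CommRingCat.of ℂ)) [IsIntegral X] [IsProper s]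
    [SmoothOfRelativeDimension 1 s]
    -- the point `(b_2, …, b_{2m-2}, p_m)` of the Hitchin base
    (m : ℕ) (hm : 1 ≤ m) (b : ∀ i : ℕ, SpectralNorm.CanonicalSection s (2 * i))
    (pm : SpectralNorm.CanonicalSection s m) (hpm : pm.HasSimpleZeros)
    (hb : 2 ≤ m → ∀ x : X, pm.VanishesAt x → ¬ (b (m - 1)).VanishesAt x)
    -- the curve `S'`, its normalization `S`, and the involution
    {S' S Sbar : Scheme.{0}} [IsReduced S']
    (π' : S' ⟶ X) (lam : SpectralNorm.PullbackSection s π')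
    (hS' : SpectralNorm.IsSpectralCurve m b pm π' lam)
    (μ : S ⟶ S') (hμ : SpectralNorm.IsNormalization μ)
    (σ' : S' ⟶ S') (hσ' : SpectralNorm.IsSignInvolution π' lam σ')
    (σ : S ⟶ S) (hσ : σ ≫ μ = μ ≫ σ')
    -- the quotient `Sbar = S / σ` and its projection to `X`
    (p : S ⟶ Sbar) (hp : SpectralNorm.IsQuotient σ p)
    (πbar : Sbar ⟶ X) (hπbar : p ≫ πbar = μ ≫ π') :
    Etale p ∧ IsFinite πbar ∧ Flat πbar ∧
      SpectralNorm.IsLineBundle (SpectralNorm.antiInvariants σ p hp.comp_eq) ∧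
      SpectralNorm.IsTwoTorsion (SpectralNorm.antiInvariants σ p hp.comp_eq) ∧
      SpectralNorm.IsNorm πbar (SpectralNorm.antiInvariants σ p hp.comp_eq)
        (SpectralNorm.structureSheaf X) := by
  have := SmoothOfRelativeDimension.smooth 1 s
  have hc := SpectralNorm.isSpectralCover hm hpm hb hS' hμ hσ' hσ hp hπbar
  exact ⟨hc.etale, hc.isFinite, hc.flat, hc.isLineBundle, hp.isTwoTorsion hc.hasLocalUnits,
    hc.isNorm⟩
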